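/- An instance $I$ of the stable matching problem with ties and laminar constraints consists of disjoint finite sets $W$ (workers) and $F$ (firms), a finite set $E$ of contracts, each of which is associated with one worker $\mathrm w(e)$ and one firm $\mathrm f(e)$ (several contracts may join the same pair), and, for each agent $a\in W\cup F$ with set $E_a$ of associated contracts, a laminar family $\mathcal L_a$ of subsets of $E_a$ (any two members are nested or disjoint), quotas $q_a:\mathcal L_a\to\mathbb Z_{\ge 0}$, and a preference list of all contracts in $E_a$ that may contain ties; $e\succ_a e'$ means that $a$ strictly prefers $e$ to $e'$. For $M\subseteq E$ put $M_a=M\cap E_a$. The set $M$ is feasible for $a$ if $|M_a\cap L|\le q_a(L)$ for all $L\in\mathcal L_a$, and it is a matching if it is feasible for all agents. A contract $e\in E\setminus M$ is free for $a\in\{\mathrm w(e),\mathrm f(e)\}$ in $M$ if $M_a\cup\{e\}$ is feasible for $a$, or there is $e'\in M_a$ with $e\succ_a e'$ and $(M_a\cup\{e\})\setminus\{e'\}$ feasible for $a$. A matching $M$ is stable if no $e\in E\setminus M$ is free for both $\mathrm w(e)$ and $\mathrm f(e)$. Let $k$ be the maximum number of members of a chain $L_1\subsetneq L_2\subsetneq\dots\subsetneq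 L_k$ in one of the families $\mathcal L_a$ ($a\in W\cup F$). Theorem. There is an algorithm (a single program of a random access machine that counts each addition, subtraction, memory access, assignment and test as one step, and that receives the contracts' endpoints in arrays and the preference list and the laminar family of each agent as explicit lists, with a table of their addresses) which, given any such instance $I$, finds a stable matching $M$ of $I$ with $|M|\ge\frac23|M_{\mathrm{OPT}}|$, where $M_{\mathrm{OPT}}$ is a maximum-cardinality stable matching of $I$, in $O(k\cdot|E|^2)$ time, i.e. in at most $C\cdot\max(k,1)\cdot\max(|E|,1)^2$ steps with a constant $C$ that does not depend on the instance. -/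

import Mathlib

/-! ## Stable matching with ties and laminar constraints -/

/-- An instance with workers `W`, firms `F` and contracts `E`; agents are the elements of `W ⊕ F`.
An agent `a` has a laminar family `lam a` of sets of its own contracts, an upper quota for each
member of the family (the value of `quota a` off `lam a` is never used), and a preference list
`prefList a`: the list of its ties (sets of equally good contracts, possibly singletons), from
the most to the least preferred, which contains each contract of `a` exactly once. -/
structure SMTILC (W F E : Type*) where
  worker : E → W
  firm : E → F
  lam : W ⊕ F → Finset (Finset E)
  quota : W ⊕ F → Finset E → ℕ
  prefList : W ⊕ F → List (Finset E)
  lam_subset : ∀ a, ∀ L ∈ lam a, ∀ e ∈ L, a = Sum.inl (worker e) ∨ a = Sum.inr (firm e)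
  laminar : ∀ a, ∀ L ∈ lam a, ∀ L' ∈ lam a, L ⊆ L' ∨ L' ⊆ L ∨ Disjoint L L'
  pref_nonempty : ∀ a, ∀ T ∈ prefList a, T.Nonempty
  pref_disjoint : ∀ a, (prefList a).Pairwise Disjoint
  pref_cover : ∀ a e, (∃ T ∈ prefList a, e ∈ T) ↔ (a = Sum.inl (worker e) ∨ a = Sum.inr (firm e))

namespace SMTILC

variable {W F E : Type*} [Fintype W] [Fintype F] [Fintype E]
  [DecidableEq W] [DecidableEq F] [DecidableEq E]

/-- The set `E_a` of the contracts of the agent `a`. -/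
def contracts (I : SMTILC W F E) (a : W ⊕ F) : Finset E :=
  Finset.univ.filter fun e => a = Sum.inl (I.worker e) ∨ a = Sum.inr (I.firm e)

/-- `e ≻_a e'`: the agent `a` strictly prefers `e` to `e'`. -/
def Prefers (I : SMTILC W F E) (a : W ⊕ F) (e e' : E) : Prop :=
  ∃ i j : Fin (I.prefList a).length, i < j ∧ e ∈ (I.prefList a).get i ∧ e' ∈ (I.prefList a).get j

/-- `M` is feasible for the agent `a`. -/
def Feasible (I : SMTILC W F E) (a : W ⊕ F) (M : Finset E) : Prop :=
  ∀ L ∈ I.lam a, ((M ∩ I.contracts a) ∩ L).card ≤ I.quota a L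

/-- `M` is a matching: feasible for all agents. -/
def IsMatching (I : SMTILC W F E) (M : Finset E) : Prop :=
  ∀ a, I.Feasible a M

/-- The contract `e` is free for the agent `a` in `M`. -/
def Free (I : SMTILC W F E) (M : Finset E) (a : W ⊕ F) (e : E) : Prop :=
  I.Feasible a (insert e (M ∩ I.contracts a)) ∨
    ∃ e' ∈ M ∩ I.contracts a, I.Prefers a e e' ∧
      I.Feasible a ((insert e (M ∩ I.contracts a)).erase e')

/-- The contract `e` blocks `M`. -/
def Blocks (I : SMTILC W F E) (M : Finset E) (e : E) : Prop :=
  e ∉ M ∧ I.Free M (Sum.inl (I.worker e)) e ∧ I.Free M (Sum.inr (I.firm e)) e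

/-- `M` is a stable matching. -/
def IsStable (I : SMTILC W F E) (M : Finset E) : Prop :=
  I.IsMatching M ∧ ∀ e, ¬ I.Blocks M e

/-- `M` is a stable matching of maximum cardinality. -/
def IsMaxStable (I : SMTILC W F E) (M : Finset E) : Prop :=
  I.IsStable M ∧ ∀ N, I.IsStable N → N.card ≤ M.card

open Classical in
/-- The maximum level of nesting of the laminar families: the largest number of members of a chain
`L₁ ⊊ L₂ ⊊ ⋯ ⊊ L_k` in the family of a single agent. -/
noncomputable def nestingLevel (I : SMTILC W F E) : ℕ :=
  Finset.univ.sup fun a : W ⊕ F =>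
    ((I.lam a).powerset.filter fun c : Finset (Finset E) => IsChain (· ⊆ ·) (c : Set (Finset E))).sup Finset.card

end SMTILC

/-! ## Random access machine with uniform cost

The machine has registers and finitely many (as many as its program mentions) unbounded arrays of
natural numbers. Its arithmetic is addition and truncated subtraction. Programs are in structured
form; every operation, memory access, assignment and test is counted as one step. -/

namespace RAM

/-- The contents of the registers and of the arrays. -/
structure State where
  reg : ℕ → ℕ
  arr : ℕ → ℕ → ℕ

/-- Expressions: constants, registers, array cells, sums, truncated differences. -/
inductive Expr where
  | lit (c : ℕ)
  | reg (x : ℕ)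
  | get (b : ℕ) (i : Expr)
  | add (e₁ e₂ : Expr)
  | sub (e₁ e₂ : Expr)

namespace Expr

/-- The value of an expression. -/
def eval (s : State) : Expr → ℕ
  | lit c => c
  | reg x => s.reg x
  | get b i => s.arr b (i.eval s)
  | add e₁ e₂ => e₁.eval s + e₂.eval s
  | sub e₁ e₂ => e₁.eval s - e₂.eval s

/-- The number of steps taken to evaluate an expression. -/
def cost : Expr → ℕ
  | lit _ => 1
  | reg _ => 1
  | get _ i => i.cost + 1
  | add e₁ e₂ => e₁.cost + e₂.cost + 1
  | sub e₁ e₂ => e₁.cost + e₂.cost + 1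

end Expr

/-- Programs. A test succeeds if the value of its expression is not zero. -/
inductive Prog where
  | skip
  | setReg (x : ℕ) (e : Expr)
  | setArr (b : ℕ) (i e : Expr)
  | seq (p q : Prog)
  | ite (e : Expr) (p q : Prog)
  | loop (e : Expr) (p : Prog)

/-- `Exec p s t s'`: started in the state `s`, the program `p` halts after exactly `t` steps in the
state `s'`. -/
inductive Exec : Prog → State → ℕ → State → Prop
  | skip (s : State) : Exec Prog.skip s 1 s
  | setReg (s : State) (x : ℕ) (e : Expr) :
      Exec (Prog.setReg x e) s (e.cost + 1)
        ⟨Function.update s.reg x (e.eval s), s.arr⟩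
  | setArr (s : State) (b : ℕ) (i e : Expr) :
      Exec (Prog.setArr b i e) s (i.cost + e.cost + 1)
        ⟨s.reg, Function.update s.arr b (Function.update (s.arr b) (i.eval s) (e.eval s))⟩
  | seq {p q : Prog} {s₁ s₂ s₃ : State} {t₁ t₂ : ℕ} (h₁ : Exec p s₁ t₁ s₂)
      (h₂ : Exec q s₂ t₂ s₃) : Exec (Prog.seq p q) s₁ (t₁ + t₂) s₃
  | ite_true {e : Expr} {p q : Prog} {s s' : State} {t : ℕ} (he : e.eval s ≠ 0)
      (h : Exec p s t s') : Exec (Prog.ite e p q) s (e.cost + 1 + t) s'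
  | ite_false {e : Expr} {p q : Prog} {s s' : State} {t : ℕ} (he : e.eval s = 0)
      (h : Exec q s t s') : Exec (Prog.ite e p q) s (e.cost + 1 + t) s'
  | loop_stop {e : Expr} {p : Prog} {s : State} (he : e.eval s = 0) :
      Exec (Prog.loop e p) s (e.cost + 1) s
  | loop_step {e : Expr} {p : Prog} {s₁ s₂ s₃ : State} {t₁ t₂ : ℕ} (he : e.eval s₁ ≠ 0)
      (h₁ : Exec p s₁ t₁ s₂) (h₂ : Exec (Prog.loop e p) s₂ t₂ s₃) :
      Exec (Prog.loop e p) s₁ (e.cost + 1 + t₁ + t₂) s₃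

/-- The machine is deterministic: running time and final state are determined. -/
theorem Exec.unique {p : Prog} {s s' s'' : State} {t t' : ℕ} (h : Exec p s t s')
    (h' : Exec p s t' s'') : t = t' ∧ s' = s'' := by
  induction h generalizing t' s'' with
  | skip | setReg | setArr => cases h'; exact ⟨rfl, rfl⟩
  | seq _ _ ih₁ ih₂ =>
    cases h' with
    | seq k₁ k₂ =>
      obtain ⟨rfl, rfl⟩ := ih₁ k₁
      obtain ⟨rfl, rfl⟩ := ih₂ k₂
      exact ⟨rfl, rfl⟩
  | ite_true he _ ih =>
    cases h' with
    | ite_true _ k => obtain ⟨rfl, rfl⟩ := ih k; exact ⟨rfl, rfl⟩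
    | ite_false he' _ => exact absurd he' he
  | ite_false he _ ih =>
    cases h' with
    | ite_true he' _ => exact absurd he he'
    | ite_false _ k => obtain ⟨rfl, rfl⟩ := ih k; exact ⟨rfl, rfl⟩
  | loop_stop he =>
    cases h' with
    | loop_stop _ => exact ⟨rfl, rfl⟩
    | loop_step he' _ _ => exact absurd he he'
  | loop_step he _ _ ih₁ ih₂ =>
    cases h' with
    | loop_stop he' => exact absurd he' he
    | loop_step _ k₁ k₂ =>
      obtain ⟨rfl, rfl⟩ := ih₁ k₁
      obtain ⟨rfl, rfl⟩ := ih₂ k₂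
      exact ⟨rfl, rfl⟩

end RAM

/-! ## Input and output format

Workers, firms and contracts are numbered from `0`; the agent number of worker `w` is `w` and that
of firm `f` is `nW + f`. -/

namespace SMTILC

/-- `l` is a listing, in some order and without repetition, of the set `T`. -/
def IsListing {α : Type*} (l : List α) (T : Finset α) : Prop :=
  l.Nodup ∧ ∀ x, x ∈ l ↔ x ∈ T

variable {nW nF n : ℕ}

/-- The number of an agent. -/
def agentCode : Fin nW ⊕ Fin nF → ℕ
  | Sum.inl w => w
  | Sum.inr f => nW + f

/-- `r` describes the preference list of `a`: the number of ties; then for each tie, in order, the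
number of its contracts followed by these contracts. -/
def IsPrefRecord (I : SMTILC (Fin nW) (Fin nF) (Fin n)) (a : Fin nW ⊕ Fin nF)
    (r : List ℕ) : Prop :=
  ∃ ties : List (List (Fin n)), List.Forall₂ IsListing ties (I.prefList a) ∧
    r = ties.length :: ties.flatMap fun l => l.length :: l.map Fin.val

/-- `r` describes the laminar family of `a`: the number of its members; then for each member, in
some order, its quota and the number of its contracts, followed by these contracts. -/
def IsLamRecord (I : SMTILC (Fin nW) (Fin nF) (Fin n)) (a : Fin nW ⊕ Fin nF)
    (r : List ℕ) : Prop :=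
  ∃ (fam : List (Finset (Fin n))) (members : List (List (Fin n))),
    IsListing fam (I.lam a) ∧ List.Forall₂ IsListing members fam ∧
    r = fam.length :: ((fam.map (I.quota a)).zip members).flatMap
      fun m => m.1 :: m.2.length :: m.2.map Fin.val

/-- The record `r` is stored in the array `m` from the address `p` on. -/
def Stored (m : ℕ → ℕ) (p : ℕ) (r : List ℕ) : Prop :=
  ∀ (i : ℕ) (hi : i < r.length), m (p + i) = r[i]

/-- The state `s` of the machine presents the instance `I` as input: registers 0, 1, 2 hold the
numbers of contracts, workers and firms; arrays 0 and 1 hold the worker and the firm of each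
contract; arrays 2 and 3 hold, for each agent, the address of its preference record in array 4 and
of its laminar family record in array 5; the other registers and arrays are cleared. -/
structure IsInput (I : SMTILC (Fin nW) (Fin nF) (Fin n)) (s : RAM.State) : Prop where
  num_contracts : s.reg 0 = n
  num_workers : s.reg 1 = nW
  num_firms : s.reg 2 = nF
  worker : ∀ e : Fin n, s.arr 0 e = I.worker e
  firm : ∀ e : Fin n, s.arr 1 e = I.firm e
  pref : ∀ a, ∃ r, I.IsPrefRecord a r ∧ Stored (s.arr 4) (s.arr 2 (agentCode a)) r
  lam : ∀ a, ∃ r, I.IsLamRecord a r ∧ Stored (s.arr 5) (s.arr 3 (agentCode a)) r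
  reg_clear : ∀ x, 3 ≤ x → s.reg x = 0
  arr_clear : ∀ b, 6 ≤ b → ∀ i, s.arr b i = 0

/-- The state `s` presents the set `M` of contracts as output: array 6 holds its indicator. -/
def IsOutput (M : Finset (Fin n)) (s : RAM.State) : Prop :=
  ∀ e : Fin n, s.arr 6 e = if e ∈ M then 1 else 0

end SMTILC

/-! ## Laminar systems of capacities -/

namespace Laminar

variable {ι E : Type*} [DecidableEq E]

/-- The sets `S i` are pairwise nested or disjoint. -/
def IsLaminar (S : ι → Finset E) : Prop :=
  ∀ i j, S i ⊆ S j ∨ S j ⊆ S i ∨ Disjoint (S i) (S j)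

/-- `X` respects the capacity `q i` of each set `S i`. -/
def Indep (S : ι → Finset E) (q : ι → ℕ) (X : Finset E) : Prop :=
  ∀ i, (X ∩ S i).card ≤ q i

/-- Some set containing `e` is used to capacity by `X`. -/
def Full (S : ι → Finset E) (q : ι → ℕ) (X : Finset E) (e : E) : Prop :=
  ∃ i, e ∈ S i ∧ q i ≤ (X ∩ S i).card

/-- Some set containing `e` is used to capacity by elements of `X` of rank at most `c`. -/
def Dominated (S : ι → Finset E) (q : ι → ℕ) (X : Finset E) (ρ : E → ℕ) (e : E) (c : ℕ) : Prop :=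
  ∃ i, e ∈ S i ∧ q i ≤ (X ∩ S i).card ∧ ∀ m ∈ X ∩ S i, ρ m ≤ c

theorem Dominated.mono {S : ι → Finset E} {q : ι → ℕ} {X : Finset E} {ρ : E → ℕ} {e : E} {c d : ℕ}
    (h : Dominated S q X ρ e c) (hcd : c ≤ d) : Dominated S q X ρ e d :=
  let ⟨i, h₁, h₂, h₃⟩ := h
  ⟨i, h₁, h₂, fun m hm => (h₃ m hm).trans hcd⟩

theorem Indep.mono {S : ι → Finset E} {q : ι → ℕ} {X Y : Finset E} (h : Indep S q Y)
    (hXY : X ⊆ Y) : Indep S q X := fun i =>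
  (Finset.card_le_card (Finset.inter_subset_inter_right hXY)).trans (h i)

theorem indep_insert {S : ι → Finset E} {q : ι → ℕ} {X : Finset E} {e : E} (hX : Indep S q X)
    (he : ¬ Full S q X e) : Indep S q (insert e X) := by
  intro i
  by_cases h : e ∈ S i
  · rw [Finset.insert_inter_of_mem h]
    have h2 : ¬ q i ≤ (X ∩ S i).card := fun h' => he ⟨i, h, h'⟩
    exact (Finset.card_insert_le _ _).trans (by omega)
  · rw [Finset.insert_inter_of_notMem h]
    exact hX i

theorem not_full_of_indep_insert {S : ι → Finset E} {q : ι → ℕ} {X : Finset E} {e : E}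
    (he : e ∉ X) (h : Indep S q (insert e X)) : ¬ Full S q X e := by
  rintro ⟨i, hi, hq⟩
  have := h i
  rw [Finset.insert_inter_of_mem hi, Finset.card_insert_of_notMem (by simp [he])] at this
  omega

theorem Dominated.insert {S : ι → Finset E} {q : ι → ℕ} {X : Finset E} {ρ : E → ℕ} {e f : E} {c : ℕ}
    (h : Dominated S q X ρ e c) (hf : ¬ Full S q X f) : Dominated S q (insert f X) ρ e c := by
  obtain ⟨i, hi, hq, hm⟩ := h
  have hfi : f ∉ S i := fun h => hf ⟨i, h, hq⟩
  refine ⟨i, hi, ?_, ?_⟩ <;> rw [Finset.insert_inter_of_notMem hfi]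
  exacts [hq, hm]

theorem Dominated.congr {S : ι → Finset E} {q : ι → ℕ} {X : Finset E} {ρ ρ' : E → ℕ} {e : E} {c : ℕ}
    (h : Dominated S q X ρ e c) (hρ : ∀ m ∈ X, ρ' m = ρ m) : Dominated S q X ρ' e c :=
  let ⟨i, hi, hq, hm⟩ := h
  ⟨i, hi, hq, fun m hmi => (hρ m (Finset.mem_inter.1 hmi).1).le.trans (hm m hmi)⟩

/-- A set which dominates every other element exists. -/
theorem exists_dominating [Fintype E] (S : ι → Finset E) (q : ι → ℕ) (ρ : E → ℕ) :
    ∃ X, Indep S q X ∧ ∀ e, e ∉ X → Dominated S q X ρ e (ρ e) := by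
  suffices h : ∀ A : Finset E, ∃ X ⊆ A, Indep S q X ∧
      ∀ e ∈ A, e ∉ X → Dominated S q X ρ e (ρ e) by
    obtain ⟨X, -, h1, h2⟩ := h Finset.univ
    exact ⟨X, h1, fun e => h2 e (Finset.mem_univ e)⟩
  intro A
  induction A using Finset.induction_on_max_value ρ with
  | empty => exact ⟨∅, by simp, fun i => by simp, by simp⟩
  | insert a A ha hmax ih =>
    obtain ⟨X, hXA, hX, hdom⟩ := ih
    by_cases hf : Full S q X a
    · refine ⟨X, hXA.trans (Finset.subset_insert _ _), hX, fun e he heX => ?_⟩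
      rcases Finset.mem_insert.1 he with rfl | he
      · obtain ⟨i, hi, hq⟩ := hf
        exact ⟨i, hi, hq, fun m hm => hmax m (hXA (Finset.mem_inter.1 hm).1)⟩
      · exact hdom e he heX
    · refine ⟨insert a X, Finset.insert_subset_insert _ hXA, indep_insert hX hf, fun e he heX => ?_⟩
      rw [Finset.mem_insert, not_or] at heX
      exact (hdom e (Finset.mem_of_mem_insert_of_ne he heX.1) heX.2).insert hf

/-- The sets containing `f` and used to capacity by `X` include a smallest one. -/
theorem exists_smallest_full {S : ι → Finset E} {q : ι → ℕ} {X : Finset E} {f : E}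
    (h : Full S q X f) : ∃ i, f ∈ S i ∧ q i ≤ (X ∩ S i).card ∧
      ∀ j, f ∈ S j → q j ≤ (X ∩ S j).card → (S i).card ≤ (S j).card := by
  classical
  have hex : ∃ k i, f ∈ S i ∧ q i ≤ (X ∩ S i).card ∧ (S i).card = k := by
    obtain ⟨i, hi, hq⟩ := h
    exact ⟨_, i, hi, hq, rfl⟩
  obtain ⟨i, hi, hq, hk⟩ := Nat.find_spec hex
  exact ⟨i, hi, hq, fun j hj hqj => hk.trans_le (Nat.find_min' hex ⟨j, hj, hqj, rfl⟩)⟩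

omit [DecidableEq E] in
theorem IsLaminar.subset_of_mem {S : ι → Finset E} (hS : IsLaminar S) {i j : ι} {f : E}
    (hi : f ∈ S i) (hj : f ∈ S j) (hc : (S i).card ≤ (S j).card) : S i ⊆ S j := by
  rcases hS i j with h | h | h
  · exact h
  · rw [Finset.eq_of_subset_of_card_le h hc]
  · exact absurd hj (Finset.disjoint_left.1 h hi)

/-- Replacing the worst element of the smallest full set. -/
theorem exchange {S : ι → Finset E} {q : ι → ℕ} (hS : IsLaminar S) {X : Finset E} {ρ : E → ℕ}
    {f r : E} {i : ι} (hX : Indep S q X) (hfX : f ∉ X) (hfi : f ∈ S i)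
    (hi : q i ≤ (X ∩ S i).card)
    (hmin : ∀ j, f ∈ S j → q j ≤ (X ∩ S j).card → (S i).card ≤ (S j).card)
    (hr : r ∈ insert f (X ∩ S i)) (hmax : ∀ m ∈ insert f (X ∩ S i), ρ m ≤ ρ r) :
    Indep S q ((insert f X).erase r) ∧
      (∀ e c, Dominated S q X ρ e c → Dominated S q ((insert f X).erase r) ρ e c) ∧
      Dominated S q ((insert f X).erase r) ρ r (ρ r) := by
  have hi' := hX i
  rcases Finset.mem_insert.1 hr with rfl | hrX
  · rw [Finset.erase_insert hfX]
    exact ⟨hX, fun e c h => h, i, hfi, hi, fun m hm => hmax m (Finset.mem_insert_of_mem hm)⟩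
  rw [Finset.mem_inter] at hrX
  obtain ⟨hrX, hri⟩ := hrX
  have hrf : r ≠ f := fun h => hfX (h ▸ hrX)
  have hcard : ∀ j, f ∈ S j → r ∈ S j →
      ((insert f X).erase r ∩ S j).card = (X ∩ S j).card := by
    intro j hj hrj
    rw [Finset.erase_inter, Finset.insert_inter_of_mem hj,
      Finset.card_erase_of_mem (Finset.mem_insert_of_mem (Finset.mem_inter.2 ⟨hrX, hrj⟩)),
      Finset.card_insert_of_notMem (fun h => hfX (Finset.mem_inter.1 h).1)]
    omega
  have hdomi : ∀ e ∈ S i, ∀ c, ρ r ≤ c → Dominated S q ((insert f X).erase r) ρ e c := by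
    intro e he c hc
    refine ⟨i, he, (hcard i hfi hri).symm ▸ hi, fun m hm => (hmax m ?_).trans hc⟩
    simp only [Finset.mem_inter, Finset.mem_erase, Finset.mem_insert] at hm ⊢
    tauto
  refine ⟨fun j => ?_, fun e c h => ?_, hdomi r hri _ le_rfl⟩
  · by_cases hj : f ∈ S j
    · by_cases hrj : r ∈ S j
      · rw [hcard j hj hrj]
        exact hX j
      · have : ¬ q j ≤ (X ∩ S j).card := fun h =>
          hrj (hS.subset_of_mem hfi hj (hmin j hj h) hri)
        refine (Finset.card_le_card (Finset.inter_subset_inter_right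
          (Finset.erase_subset _ _))).trans ?_
        rw [Finset.insert_inter_of_mem hj]
        exact (Finset.card_insert_le _ _).trans (by omega)
    · refine (Finset.card_le_card (Finset.inter_subset_inter_right
          (Finset.erase_subset _ _))).trans ?_
      rw [Finset.insert_inter_of_notMem hj]
      exact hX j
  · obtain ⟨j, hej, hq, hm⟩ := h
    by_cases hrj : r ∈ S j
    · have hrc := hm r (Finset.mem_inter.2 ⟨hrX, hrj⟩)
      by_cases hj : f ∈ S j
      · refine ⟨j, hej, (hcard j hj hrj).symm ▸ hq, fun m hmj => ?_⟩
        simp only [Finset.mem_inter, Finset.mem_erase, Finset.mem_insert] at hmj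
        rcases hmj with ⟨⟨-, rfl | h⟩, h'⟩
        · exact (hmax m (Finset.mem_insert_self _ _)).trans hrc
        · exact hm m (Finset.mem_inter.2 ⟨h, h'⟩)
      · rcases hS i j with h | h | h
        · exact absurd (h hfi) hj
        · exact hdomi e (h hej) c hrc
        · exact absurd hrj (Finset.disjoint_left.1 h hri)
    · have hj : f ∉ S j := fun hj => hrj (hS.subset_of_mem hfi hj (hmin j hj hq) hri)
      have : (insert f X).erase r ∩ S j = X ∩ S j := by
        ext m
        simp only [Finset.mem_inter, Finset.mem_erase, Finset.mem_insert]
        constructor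
        · rintro ⟨⟨-, rfl | h⟩, h'⟩
          exacts [absurd h' hj, ⟨h, h'⟩]
        · rintro ⟨h, h'⟩
          exact ⟨⟨fun h'' => hrj (h'' ▸ h'), Or.inr h⟩, h'⟩
      refine ⟨j, hej, ?_, ?_⟩ <;> rw [this]
      exacts [hq, hm]

/-- A best element that can be added to a subset `M` of a dominating set belongs to a dominating
set which includes `M`. -/
theorem exists_dominating_insert {S : ι → Finset E} {q : ι → ℕ} (hS : IsLaminar S)
    {X M : Finset E} {ρ : E → ℕ} {avail : E → Prop} {f : E} (hX : Indep S q X) (hMX : M ⊆ X)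
    (hav : ∀ e ∈ X, avail e)
    (hdom : ∀ e, e ∉ X → avail e → Dominated S q X ρ e (ρ e)) (hf : ¬ Full S q M f)
    (hfM : f ∉ M) (hfa : avail f)
    (hbest : ∀ g, g ∉ M → avail g → ¬ Full S q M g → ρ f ≤ ρ g) :
    ∃ X', Indep S q X' ∧ insert f M ⊆ X' ∧ (∀ e ∈ X', avail e) ∧
      ∀ e, e ∉ X' → avail e → Dominated S q X' ρ e (ρ e) := by
  by_cases hfX : f ∈ X
  · exact ⟨X, hX, Finset.insert_subset hfX hMX, hav, hdom⟩
  obtain ⟨j, hfj, hqj, hmj⟩ := hdom f hfX hfa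
  obtain ⟨i, hfi, hqi, hmin⟩ := exists_smallest_full ⟨j, hfj, hqj⟩
  have hij := hS.subset_of_mem hfi hfj (hmin j hfj hqj)
  have h1 : (M ∩ S i).card < (X ∩ S i).card := by
    by_contra h
    exact hf ⟨i, hfi, by omega⟩
  obtain ⟨g, hg, hgM⟩ := Finset.exists_mem_notMem_of_card_lt_card h1
  have hg' := Finset.mem_inter.1 hg
  have hgM' : g ∉ M := fun h => hgM (Finset.mem_inter.2 ⟨h, hg'.2⟩)
  have hle : ∀ m ∈ X ∩ S i, ρ m ≤ ρ f := fun m hm =>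
    hmj m (Finset.inter_subset_inter_left hij hm)
  have hfg : ρ f ≤ ρ g := hbest g hgM' (hav g hg'.1) (not_full_of_indep_insert hgM'
    (hX.mono (Finset.insert_subset hg'.1 hMX)))
  obtain ⟨h2, h3, h4⟩ := exchange hS (ρ := ρ) (r := g) hX hfX hfi hqi hmin
    (Finset.mem_insert_of_mem hg) (by
      intro m hm
      rcases Finset.mem_insert.1 hm with rfl | hm
      · exact hfg
      · exact (hle m hm).trans hfg)
  refine ⟨_, h2, ?_, ?_, ?_⟩
  · intro m hm
    rw [Finset.mem_erase]
    rcases Finset.mem_insert.1 hm with rfl | hm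
    · exact ⟨fun h => hfX (h ▸ hg'.1), Finset.mem_insert_self _ _⟩
    · exact ⟨fun h => hgM' (h ▸ hm), Finset.mem_insert_of_mem (hMX hm)⟩
  · intro e he
    rcases Finset.mem_insert.1 (Finset.mem_of_mem_erase he) with rfl | he
    exacts [hfa, hav e he]
  · intro e he ha
    by_cases heg : e = g
    · exact heg ▸ h4
    · refine h3 _ _ (hdom e (fun h => he ?_) ha)
      exact Finset.mem_erase.2 ⟨heg, Finset.mem_insert_of_mem h⟩

/-- When an element of a dominating set becomes worse or unavailable, it can be replaced by the best
remaining one. -/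
theorem exists_dominating_of_worse [Fintype E] {S : ι → Finset E} {q : ι → ℕ} (hS : IsLaminar S)
    {X : Finset E} {ρ ρ' : E → ℕ} {avail avail' : E → Prop} {r : E} (hX : Indep S q X)
    (hrX : r ∈ X) (hρ : ∀ e, e ≠ r → ρ' e = ρ e)
    (hav' : ∀ e, e ≠ r → (avail' e ↔ avail e)) (hav : ∀ e ∈ X, avail e)
    (hdom : ∀ e, e ∉ X → avail e → Dominated S q X ρ e (ρ e)) :
    ∃ X', Indep S q X' ∧ X.erase r ⊆ X' ∧ (∀ e ∈ X', avail' e) ∧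
      ∀ e, e ∉ X' → avail' e → Dominated S q X' ρ' e (ρ' e) := by
  classical
  have hX0 : Indep S q (X.erase r) := hX.mono (Finset.erase_subset _ _)
  have havr : ∀ e ∈ X.erase r, avail' e := fun e he =>
    (hav' e (Finset.mem_erase.1 he).1).2 (hav e (Finset.mem_erase.1 he).2)
  have hrfull : ¬ Full S q (X.erase r) r := not_full_of_indep_insert (by simp)
    (by rwa [Finset.insert_erase hrX])
  have hdom0 : ∀ e, e ∉ X → avail e → Full S q (X.erase r) e →
      Dominated S q (X.erase r) ρ' e (ρ e) := by
    intro e heX hea hfull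
    obtain ⟨i, hei, hqi, hm⟩ := hdom e heX hea
    have key : ∀ j, e ∈ S j → q j ≤ (X.erase r ∩ S j).card → S j ⊆ S i →
        Dominated S q (X.erase r) ρ' e (ρ e) := by
      intro j hej hqj hji
      refine ⟨j, hej, hqj, fun m hmj => ?_⟩
      rw [Finset.mem_inter, Finset.mem_erase] at hmj
      rw [hρ m hmj.1.1]
      exact hm m (Finset.mem_inter.2 ⟨hmj.1.2, hji hmj.2⟩)
    by_cases hri : r ∈ S i
    · obtain ⟨j, hej, hqj⟩ := hfull
      have hrj : r ∉ S j := fun h => hrfull ⟨j, h, hqj⟩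
      rcases hS j i with h | h | h
      · exact key j hej hqj h
      · exact absurd (h hri) hrj
      · exact absurd hei (Finset.disjoint_left.1 h hej)
    · refine key i hei ?_ subset_rfl
      rwa [Finset.erase_inter, Finset.erase_eq_of_notMem (fun h => hri (Finset.mem_inter.1 h).2)]
  by_cases hC : (Finset.univ.filter fun c =>
      c ∉ X.erase r ∧ avail' c ∧ ¬ Full S q (X.erase r) c).Nonempty
  · obtain ⟨f, hf, hmin⟩ := Finset.exists_min_image _ ρ' hC
    simp only [Finset.mem_filter, Finset.mem_univ, true_and] at hf hmin
    obtain ⟨hfX, hfa, hff⟩ := hf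
    refine ⟨insert f (X.erase r), indep_insert hX0 hff, Finset.subset_insert _ _, ?_, ?_⟩
    · intro e he
      rcases Finset.mem_insert.1 he with rfl | he
      exacts [hfa, havr e he]
    intro e he hea
    rw [Finset.mem_insert, not_or] at he
    have hcard : ∀ j, f ∈ S j → r ∈ S j →
        (insert f (X.erase r) ∩ S j).card = (X ∩ S j).card := by
      intro j hj hrj
      rw [Finset.insert_inter_of_mem hj,
        Finset.card_insert_of_notMem (fun h => hfX (Finset.mem_inter.1 h).1),
        Finset.erase_inter, Finset.card_erase_of_mem (Finset.mem_inter.2 ⟨hrX, hrj⟩)]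
      have : 0 < (X ∩ S j).card := Finset.card_pos.2 ⟨r, Finset.mem_inter.2 ⟨hrX, hrj⟩⟩
      omega
    have hwit : f ≠ r → ∃ i, f ∈ S i ∧ r ∈ S i ∧ ∀ e' ∈ S i,
        Dominated S q (insert f (X.erase r)) ρ' e' (ρ' f) := by
      intro hfr
      have hfX' : f ∉ X := fun h => hfX (Finset.mem_erase.2 ⟨hfr, h⟩)
      obtain ⟨i, hfi, hqi, hm⟩ := hdom f hfX' ((hav' f hfr).1 hfa)
      have hri : r ∈ S i := by
        by_contra hri
        refine hff ⟨i, hfi, ?_⟩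
        rwa [Finset.erase_inter,
          Finset.erase_eq_of_notMem (fun h => hri (Finset.mem_inter.1 h).2)]
      refine ⟨i, hfi, hri, fun e' he' => ⟨i, he', (hcard i hfi hri).symm ▸ hqi, fun m hmi => ?_⟩⟩
      simp only [Finset.mem_inter, Finset.mem_erase, Finset.mem_insert] at hmi
      rcases hmi with ⟨rfl | ⟨h, h'⟩, h''⟩
      · exact le_rfl
      · rw [hρ m h, hρ f hfr]
        exact hm m (Finset.mem_inter.2 ⟨h', h''⟩)
    by_cases her : e = r
    · subst her
      obtain ⟨i, -, hri, hd⟩ := hwit (Ne.symm he.1)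
      exact (hd e hri).mono (hmin e ⟨he.2, hea, hrfull⟩)
    · have heX : e ∉ X := fun h => he.2 (Finset.mem_erase.2 ⟨her, h⟩)
      have hea' := (hav' e her).1 hea
      by_cases hef : Full S q (X.erase r) e
      · rw [hρ e her]
        exact (hdom0 e heX hea' hef).insert hff
      · have hfe := hmin e ⟨he.2, hea, hef⟩
        obtain ⟨i, hei, hqi, hm⟩ := hdom e heX hea'
        have hri : r ∈ S i := by
          by_contra hri
          refine hef ⟨i, hei, ?_⟩
          rwa [Finset.erase_inter,
            Finset.erase_eq_of_notMem (fun h => hri (Finset.mem_inter.1 h).2)]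
        have hi : f ∈ S i → Dominated S q (insert f (X.erase r)) ρ' e (ρ' e) := by
          intro hfi
          refine ⟨i, hei, (hcard i hfi hri).symm ▸ hqi, fun m hmi => ?_⟩
          simp only [Finset.mem_inter, Finset.mem_erase, Finset.mem_insert] at hmi
          rcases hmi with ⟨rfl | ⟨h, h'⟩, h''⟩
          · exact hfe
          · rw [hρ m h, hρ e her]
            exact hm m (Finset.mem_inter.2 ⟨h', h''⟩)
        by_cases hfr : f = r
        · exact hi (hfr ▸ hri)
        · obtain ⟨j, hfj, hrj, hd⟩ := hwit hfr
          rcases hS j i with h | h | h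
          · exact hi (h hfj)
          · exact (hd e (h hei)).mono hfe
          · exact absurd hri (Finset.disjoint_left.1 h hrj)
  · rw [Finset.not_nonempty_iff_eq_empty, Finset.filter_eq_empty_iff] at hC
    refine ⟨X.erase r, hX0, subset_rfl, havr, fun e he hea => ?_⟩
    have hef : Full S q (X.erase r) e := by
      by_contra h
      exact hC (Finset.mem_univ e) ⟨he, hea, h⟩
    have her : e ≠ r := fun h => hrfull (h ▸ hef)
    rw [hρ e her]
    exact hdom0 e (fun h => he (Finset.mem_erase.2 ⟨her, h⟩)) ((hav' e her).1 hea) hef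

/-- Two disjoint sets can be partially paired so that, in every set of a laminar family, elements of
one kind without partner in this set occur only if the set has more elements of this kind. -/
theorem exists_pairing {S : ι → Finset E} (hS : IsLaminar S) (A B : Finset E) :
    ∃ P : Finset (E × E), (∀ p ∈ P, p.1 ∈ A ∧ p.2 ∈ B) ∧
      (∀ p ∈ P, ∃ i, p.1 ∈ S i ∧ p.2 ∈ S i) ∧ Set.InjOn Prod.fst (P : Set (E × E)) ∧
      Set.InjOn Prod.snd (P : Set (E × E)) ∧
      (∀ i, ∀ a ∈ A ∩ S i, (∀ p ∈ P, p.1 = a → p.2 ∉ S i) → (B ∩ S i).card < (A ∩ S i).card) ∧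
      (∀ i, ∀ b ∈ B ∩ S i, (∀ p ∈ P, p.2 = b → p.1 ∉ S i) → (A ∩ S i).card < (B ∩ S i).card) := by
  classical
  induction hn : A.card using Nat.strong_induction_on generalizing A B with
  | _ n ih =>
  by_cases hex : ∃ k i, (A ∩ S i).Nonempty ∧ (B ∩ S i).Nonempty ∧ (S i).card = k
  · obtain ⟨i, ⟨a, ha⟩, ⟨b, hb⟩, hk⟩ := Nat.find_spec hex
    have hmin : ∀ j, (A ∩ S j).Nonempty → (B ∩ S j).Nonempty → (S i).card ≤ (S j).card :=
      fun j h1 h2 => hk.trans_le (Nat.find_min' hex ⟨j, h1, h2, rfl⟩)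
    rw [Finset.mem_inter] at ha hb
    have hnot : ∀ j, (a ∈ S j ↔ b ∉ S j) → ¬ ((A ∩ S j).Nonempty ∧ (B ∩ S j).Nonempty) := by
      rintro j hj ⟨h1, h2⟩
      have hc := hmin j h1 h2
      by_cases haj : a ∈ S j
      · exact hj.1 haj (hS.subset_of_mem ha.2 haj hc hb.2)
      · have hbj : b ∈ S j := by tauto
        exact haj (hS.subset_of_mem hb.2 hbj hc ha.2)
    obtain ⟨P, hP, hPS, hP1, hP2, hPA, hPB⟩ := ih (A.erase a).card
      (by rw [← hn]; exact Finset.card_erase_lt_of_mem ha.1) (A.erase a) (B.erase b) rfl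
    have hsame : ∀ j, (a ∈ S j ↔ b ∈ S j) →
        ((A.erase a ∩ S j).card < (B.erase b ∩ S j).card ↔ (A ∩ S j).card < (B ∩ S j).card) ∧
        ((B.erase b ∩ S j).card < (A.erase a ∩ S j).card ↔ (B ∩ S j).card < (A ∩ S j).card) := by
      intro j hj
      rw [Finset.erase_inter, Finset.erase_inter]
      by_cases haj : a ∈ S j
      · rw [Finset.card_erase_of_mem (Finset.mem_inter.2 ⟨ha.1, haj⟩),
          Finset.card_erase_of_mem (Finset.mem_inter.2 ⟨hb.1, hj.1 haj⟩)]
        have h1 : 0 < (A ∩ S j).card := Finset.card_pos.2 ⟨a, Finset.mem_inter.2 ⟨ha.1, haj⟩⟩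
        have h2 : 0 < (B ∩ S j).card :=
          Finset.card_pos.2 ⟨b, Finset.mem_inter.2 ⟨hb.1, hj.1 haj⟩⟩
        omega
      · rw [Finset.erase_eq_of_notMem (fun h => haj (Finset.mem_inter.1 h).2),
          Finset.erase_eq_of_notMem (fun h => haj (hj.2 (Finset.mem_inter.1 h).2))]
        exact ⟨Iff.rfl, Iff.rfl⟩
    refine ⟨insert (a, b) P, ?_, ?_, ?_, ?_, ?_, ?_⟩
    · intro p hp
      rcases Finset.mem_insert.1 hp with rfl | hp
      · exact ⟨ha.1, hb.1⟩
      · exact ⟨Finset.mem_of_mem_erase (hP p hp).1, Finset.mem_of_mem_erase (hP p hp).2⟩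
    · intro p hp
      rcases Finset.mem_insert.1 hp with rfl | hp
      · exact ⟨i, ha.2, hb.2⟩
      · exact hPS p hp
    · rw [Finset.coe_insert, Set.injOn_insert (fun h => by simpa using (hP _ h).1)]
      refine ⟨hP1, ?_⟩
      rintro ⟨p, hp, h⟩
      exact absurd h (Finset.mem_erase.1 (hP p hp).1).1
    · rw [Finset.coe_insert, Set.injOn_insert (fun h => by simpa using (hP _ h).2)]
      refine ⟨hP2, ?_⟩
      rintro ⟨p, hp, h⟩
      exact absurd h (Finset.mem_erase.1 (hP p hp).2).1
    · intro j x hx hxP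
      by_cases hj : a ∈ S j ↔ b ∈ S j
      · rw [← (hsame j hj).2]
        refine hPA j x ?_ (fun p hp => hxP p (Finset.mem_insert_of_mem hp))
        rw [Finset.erase_inter, Finset.mem_erase]
        refine ⟨?_, hx⟩
        rintro rfl
        exact hxP (x, b) (Finset.mem_insert_self _ _) rfl (hj.1 (Finset.mem_inter.1 hx).2)
      · have := hnot j (by tauto)
        have hB : B ∩ S j = ∅ := by
          by_contra h
          exact this ⟨⟨x, hx⟩, Finset.nonempty_iff_ne_empty.2 h⟩
        rw [hB, Finset.card_empty]
        exact Finset.card_pos.2 ⟨x, hx⟩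
    · intro j x hx hxP
      by_cases hj : a ∈ S j ↔ b ∈ S j
      · rw [← (hsame j hj).1]
        refine hPB j x ?_ (fun p hp => hxP p (Finset.mem_insert_of_mem hp))
        rw [Finset.erase_inter, Finset.mem_erase]
        refine ⟨?_, hx⟩
        rintro rfl
        exact hxP (a, x) (Finset.mem_insert_self _ _) rfl (hj.2 (Finset.mem_inter.1 hx).2)
      · have := hnot j (by tauto)
        have hA : A ∩ S j = ∅ := by
          by_contra h
          exact this ⟨Finset.nonempty_iff_ne_empty.2 h, ⟨x, hx⟩⟩
        rw [hA, Finset.card_empty]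
        exact Finset.card_pos.2 ⟨x, hx⟩
  · have hno : ∀ i, (A ∩ S i).Nonempty → B ∩ S i = ∅ := by
      intro i h1
      by_contra h2
      exact hex ⟨_, i, h1, Finset.nonempty_iff_ne_empty.2 h2, rfl⟩
    refine ⟨∅, by simp, by simp, by simp, by simp, ?_, ?_⟩
    · intro i x hx _
      rw [hno i ⟨x, hx⟩, Finset.card_empty]
      exact Finset.card_pos.2 ⟨x, hx⟩
    · intro i x hx _
      have : A ∩ S i = ∅ := by
        by_contra h
        have h' := hno i (Finset.nonempty_iff_ne_empty.2 h)
        rw [h'] at hx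
        exact absurd hx (Finset.notMem_empty x)
      rw [this, Finset.card_empty]
      exact Finset.card_pos.2 ⟨x, hx⟩

theorem card_inter_lt {M N L : Finset E} (h : ((M \ N) ∩ L).card < ((N \ M) ∩ L).card) :
    (M ∩ L).card < (N ∩ L).card := by
  rw [Finset.sdiff_inter_right_comm, Finset.sdiff_inter_right_comm] at h
  have h1 := Finset.card_sdiff_add_card_inter (M ∩ L) N
  have h2 := Finset.card_sdiff_add_card_inter (N ∩ L) M
  have h3 : M ∩ L ∩ N = N ∩ L ∩ M := by ext; simp; tauto
  rw [h3] at h1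
  omega

theorem indep_exchange {S : ι → Finset E} {q : ι → ℕ} {M : Finset E} {a b : E}
    (hM : Indep S q M) (haM : a ∉ M) (hb : b ∈ M)
    (h : ∀ i, a ∈ S i → b ∉ S i → (M ∩ S i).card < q i) :
    Indep S q ((insert a M).erase b) := by
  have hab : a ≠ b := fun h => haM (h ▸ hb)
  intro i
  have hi := hM i
  by_cases ha : a ∈ S i
  · rw [Finset.erase_inter, Finset.insert_inter_of_mem ha]
    by_cases hbi : b ∈ S i
    · rw [Finset.card_erase_of_mem (Finset.mem_insert_of_mem (Finset.mem_inter.2 ⟨hb, hbi⟩)),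
        Finset.card_insert_of_notMem (fun h => haM (Finset.mem_inter.1 h).1)]
      omega
    · have := h i ha hbi
      exact (Finset.card_le_card (Finset.erase_subset _ _)).trans
        ((Finset.card_insert_le _ _).trans this)
  · refine (Finset.card_le_card (Finset.inter_subset_inter_right
      (Finset.erase_subset _ _))).trans ?_
    rwa [Finset.insert_inter_of_notMem ha]

/-- Two independent sets admit a partial pairing of their differences along exchanges that are
possible in both of them. -/
theorem exists_exchange_pairing {S : ι → Finset E} {q : ι → ℕ} (hS : IsLaminar S) {M N : Finset E}
    (hM : Indep S q M) (hN : Indep S q N) : ∃ P : Finset (E × E),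
      (∀ p ∈ P, p.1 ∈ N \ M ∧ p.2 ∈ M \ N) ∧ (∀ p ∈ P, ∃ i, p.1 ∈ S i ∧ p.2 ∈ S i) ∧
      Set.InjOn Prod.fst (P : Set (E × E)) ∧ Set.InjOn Prod.snd (P : Set (E × E)) ∧
      (∀ p ∈ P, Indep S q ((insert p.1 M).erase p.2) ∧ Indep S q ((insert p.2 N).erase p.1)) ∧
      ∀ a ∈ N \ M, a ∉ P.image Prod.fst → Indep S q (insert a M) := by
  obtain ⟨P, hP, hPS, hP1, hP2, hA, hB⟩ := exists_pairing hS (N \ M) (M \ N)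
  refine ⟨P, hP, hPS, hP1, hP2, fun p hp => ?_, fun a ha haP => ?_⟩
  · obtain ⟨h1, h2⟩ := hP p hp
    have h1' := Finset.mem_sdiff.1 h1
    have h2' := Finset.mem_sdiff.1 h2
    refine ⟨indep_exchange hM h1'.2 h2'.1 fun i h3 h4 => ?_,
      indep_exchange hN h2'.2 h1'.1 fun i h3 h4 => ?_⟩
    · refine (card_inter_lt (hA i p.1 (Finset.mem_inter.2 ⟨h1, h3⟩) fun p' hp' he => ?_)).trans_le
        (hN i)
      rwa [hP1 hp' hp he]
    · refine (card_inter_lt (hB i p.2 (Finset.mem_inter.2 ⟨h2, h3⟩) fun p' hp' he => ?_)).trans_le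
        (hM i)
      rwa [hP2 hp' hp he]
  · refine indep_insert hM ?_
    rintro ⟨i, hi, hq⟩
    have := card_inter_lt (hA i a (Finset.mem_inter.2 ⟨ha, hi⟩) fun p hp he =>
      absurd (Finset.mem_image.2 ⟨p, hp, he⟩) haP)
    have := hN i
    omega

end Laminar

/-! ## Certified matchings -/

namespace SMTILC

set_option linter.unusedSectionVars false

open Laminar

section Sides

variable {W F E A : Type*} [DecidableEq E]

/-- No set of the laminar family of `a` that contains `e` leaves room in `M`. -/
def NoRoom (I : SMTILC W F E) (a : W ⊕ F) (M : Finset E) (e : E) : Prop :=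
  ∃ L ∈ I.lam a, e ∈ L ∧ I.quota a L ≤ (M ∩ L).card

/-- Some set of the laminar family of `a` that contains `e` is used to capacity by contracts whose
rank is at most `c`. -/
def Saturated (I : SMTILC W F E) (a : W ⊕ F) (M : Finset E) (ρ : E → ℕ) (e : E) (c : ℕ) : Prop :=
  ∃ L ∈ I.lam a, e ∈ L ∧ I.quota a L ≤ (M ∩ L).card ∧ ∀ m ∈ M ∩ L, ρ m ≤ c

/-- The members of the laminar families of the agents on one side. -/
def Side (I : SMTILC W F E) (s : A → W ⊕ F) : Type _ :=
  {p : A × Finset E // p.2 ∈ I.lam (s p.1)}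

/-- The set of contracts of a member of a laminar family. -/
def sideSet (I : SMTILC W F E) (s : A → W ⊕ F) (p : I.Side s) : Finset E := p.1.2

/-- The quota of a member of a laminar family. -/
def sideQuota (I : SMTILC W F E) (s : A → W ⊕ F) (p : I.Side s) : ℕ := I.quota (s p.1.1) p.1.2

/-- `o e` is the agent of `e` on the side `s`. -/
def Owns (I : SMTILC W F E) (s : A → W ⊕ F) (o : E → A) : Prop :=
  ∀ x e, (s x = Sum.inl (I.worker e) ∨ s x = Sum.inr (I.firm e)) ↔ o e = x

theorem owns_worker (I : SMTILC W F E) : I.Owns Sum.inl I.worker := fun x e => by simp [eq_comm]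

theorem owns_firm (I : SMTILC W F E) : I.Owns Sum.inr I.firm := fun x e => by simp [eq_comm]

variable {I : SMTILC W F E} {s : A → W ⊕ F} {o : E → A}

theorem Owns.eq_of_mem (h : I.Owns s o) {x : A} {L : Finset E} (hL : L ∈ I.lam (s x)) {e : E}
    (he : e ∈ L) : o e = x :=
  (h x e).1 (I.lam_subset _ L hL e he)

theorem Owns.isLaminar (h : I.Owns s o) : IsLaminar (I.sideSet s) := by
  rintro ⟨⟨x, L⟩, hL⟩ ⟨⟨y, L'⟩, hL'⟩
  by_cases hxy : x = y
  · subst hxy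
    exact I.laminar _ L hL L' hL'
  · refine Or.inr (Or.inr (Finset.disjoint_left.2 fun e he he' => hxy ?_))
    exact (h.eq_of_mem hL he).symm.trans (h.eq_of_mem hL' he')

theorem Owns.full_iff (h : I.Owns s o) {M : Finset E} {e : E} :
    Full (I.sideSet s) (I.sideQuota s) M e ↔ I.NoRoom (s (o e)) M e := by
  constructor
  · rintro ⟨⟨⟨x, L⟩, hL⟩, he, hq⟩
    obtain rfl := h.eq_of_mem hL he
    exact ⟨L, hL, he, hq⟩
  · rintro ⟨L, hL, he, hq⟩
    exact ⟨⟨⟨_, L⟩, hL⟩, he, hq⟩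

theorem Owns.dominated_iff (h : I.Owns s o) {M : Finset E} {ρ : E → ℕ} {e : E} {c : ℕ} :
    Dominated (I.sideSet s) (I.sideQuota s) M ρ e c ↔ I.Saturated (s (o e)) M ρ e c := by
  constructor
  · rintro ⟨⟨⟨x, L⟩, hL⟩, he, hq⟩
    obtain rfl := h.eq_of_mem hL he
    exact ⟨L, hL, he, hq⟩
  · rintro ⟨L, hL, he, hq⟩
    exact ⟨⟨⟨_, L⟩, hL⟩, he, hq⟩

end Sides

variable {W F E : Type*} [Fintype W] [Fintype F] [Fintype E]
  [DecidableEq W] [DecidableEq F] [DecidableEq E]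

theorem mem_contracts {I : SMTILC W F E} {a : W ⊕ F} {e : E} :
    e ∈ I.contracts a ↔ a = Sum.inl (I.worker e) ∨ a = Sum.inr (I.firm e) := by
  simp [contracts]

theorem subset_contracts {I : SMTILC W F E} {a : W ⊕ F} {L : Finset E} (hL : L ∈ I.lam a) :
    L ⊆ I.contracts a := fun e he => mem_contracts.2 (I.lam_subset a L hL e he)

theorem feasible_iff {I : SMTILC W F E} {a : W ⊕ F} {M : Finset E} :
    I.Feasible a M ↔ ∀ L ∈ I.lam a, (M ∩ L).card ≤ I.quota a L := by
  refine forall₂_congr fun L hL => ?_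
  rw [Finset.inter_assoc, Finset.inter_eq_right.2 (subset_contracts hL)]

theorem feasible_congr {I : SMTILC W F E} {a : W ⊕ F} {M N : Finset E}
    (h : M ∩ I.contracts a = N ∩ I.contracts a) : I.Feasible a M ↔ I.Feasible a N := by
  unfold Feasible
  rw [h]

theorem free_iff {I : SMTILC W F E} {a : W ⊕ F} {M : Finset E} {e : E} :
    I.Free M a e ↔ I.Feasible a (insert e M) ∨
      ∃ e' ∈ M ∩ I.contracts a, I.Prefers a e e' ∧ I.Feasible a ((insert e M).erase e') := by
  unfold Free
  refine or_congr (feasible_congr ?_) (exists_congr fun e' => and_congr_right fun _ =>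
    and_congr_right fun _ => feasible_congr ?_)
  all_goals ext x; simp; tauto

theorem side_indep_iff {A : Type*} {I : SMTILC W F E} {s : A → W ⊕ F} {M : Finset E} :
    Indep (I.sideSet s) (I.sideQuota s) M ↔ ∀ x, I.Feasible (s x) M := by
  constructor
  · exact fun h x => feasible_iff.2 fun L hL => h ⟨⟨x, L⟩, hL⟩
  · rintro h ⟨⟨x, L⟩, hL⟩
    exact feasible_iff.1 (h x) L hL

theorem not_feasible_insert {I : SMTILC W F E} {a : W ⊕ F} {M : Finset E} {e : E}
    (h : I.NoRoom a M e) (he : e ∉ M) : ¬ I.Feasible a (insert e M) := by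
  obtain ⟨L, hL, heL, hq⟩ := h
  intro hf
  have := feasible_iff.1 hf L hL
  rw [Finset.insert_inter_of_mem heL, Finset.card_insert_of_notMem
    (fun h => he (Finset.mem_inter.1 h).1)] at this
  omega

theorem Saturated.noRoom {I : SMTILC W F E} {a : W ⊕ F} {M : Finset E} {ρ : E → ℕ} {e : E} {c : ℕ}
    (h : I.Saturated a M ρ e c) : I.NoRoom a M e :=
  let ⟨L, h1, h2, h3, _⟩ := h
  ⟨L, h1, h2, h3⟩

theorem Saturated.rank_le {I : SMTILC W F E} {a : W ⊕ F} {M : Finset E} {ρ : E → ℕ} {e m : E}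
    {c : ℕ} (h : I.Saturated a M ρ e c) (he : e ∉ M) (hm : m ∈ M)
    (hf : I.Feasible a ((insert e M).erase m)) : ρ m ≤ c := by
  obtain ⟨L, hL, heL, hq, hr⟩ := h
  refine hr m (Finset.mem_inter.2 ⟨hm, ?_⟩)
  by_contra hmL
  have := feasible_iff.1 hf L hL
  rw [Finset.erase_inter, Finset.erase_eq_of_notMem (fun h => hmL (Finset.mem_inter.1 h).2),
    Finset.insert_inter_of_mem heL, Finset.card_insert_of_notMem
    (fun h => he (Finset.mem_inter.1 h).1)] at this
  omega

/-- The position in the preference list of `a` of the tie that contains `e`. -/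
def tieIndex (I : SMTILC W F E) (a : W ⊕ F) (e : E) : ℕ :=
  (I.prefList a).findIdx fun T => decide (e ∈ T)

theorem tieIndex_lt_length {I : SMTILC W F E} {a : W ⊕ F} {e : E} (he : e ∈ I.contracts a) :
    I.tieIndex a e < (I.prefList a).length := by
  obtain ⟨T, hT, heT⟩ := (I.pref_cover a e).2 (mem_contracts.1 he)
  exact List.findIdx_lt_length_of_exists ⟨T, hT, by simpa using heT⟩

theorem mem_getElem_tieIndex {I : SMTILC W F E} {a : W ⊕ F} {e : E} (he : e ∈ I.contracts a) :
    e ∈ (I.prefList a)[I.tieIndex a e]'(tieIndex_lt_length he) := by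
  have := List.findIdx_getElem (p := fun T => decide (e ∈ T)) (w := tieIndex_lt_length he)
  exact of_decide_eq_true this

theorem tieIndex_eq {I : SMTILC W F E} {a : W ⊕ F} {e : E} {i : ℕ}
    (hi : i < (I.prefList a).length) (he : e ∈ (I.prefList a)[i]) : I.tieIndex a e = i := by
  have hc : e ∈ I.contracts a :=
    mem_contracts.2 ((I.pref_cover a e).1 ⟨_, List.getElem_mem hi, he⟩)
  have h1 := mem_getElem_tieIndex hc
  have hp := List.pairwise_iff_getElem.1 (I.pref_disjoint a)
  rcases lt_trichotomy (I.tieIndex a e) i with h | h | h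
  · exact absurd he (Finset.disjoint_left.1 (hp _ _ (tieIndex_lt_length hc) hi h) h1)
  · exact h
  · exact absurd h1 (Finset.disjoint_left.1 (hp _ _ hi (tieIndex_lt_length hc) h) he)

theorem Prefers.tieIndex_lt {I : SMTILC W F E} {a : W ⊕ F} {e e' : E} (h : I.Prefers a e e') :
    I.tieIndex a e < I.tieIndex a e' := by
  obtain ⟨i, j, hij, hi, hj⟩ := h
  rwa [tieIndex_eq i.2 hi, tieIndex_eq j.2 hj]

theorem prefers_of_tieIndex_lt {I : SMTILC W F E} {a : W ⊕ F} {e e' : E} (he : e ∈ I.contracts a)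
    (he' : e' ∈ I.contracts a) (h : I.tieIndex a e < I.tieIndex a e') : I.Prefers a e e' :=
  ⟨⟨_, tieIndex_lt_length he⟩, ⟨_, tieIndex_lt_length he'⟩, h, mem_getElem_tieIndex he,
    mem_getElem_tieIndex he'⟩

theorem sum_card_prefList (I : SMTILC W F E) (a : W ⊕ F) :
    ((I.prefList a).map Finset.card).sum = (I.contracts a).card := by
  have key : ∀ l : List (Finset E), l.Pairwise Disjoint → ∀ S : Finset E,
      (∀ e, (∃ T ∈ l, e ∈ T) ↔ e ∈ S) → (l.map Finset.card).sum = S.card := by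
    intro l
    induction l with
    | nil =>
      intro _ S hS
      have : S = ∅ := Finset.eq_empty_of_forall_notMem fun e he => by simpa using (hS e).2 he
      simp [this]
    | cons T l ih =>
      intro hp S hS
      rw [List.pairwise_cons] at hp
      have hTS : T ⊆ S := fun e he => (hS e).1 ⟨T, by simp, he⟩
      rw [List.map_cons, List.sum_cons, ih hp.2 (S \ T), Finset.card_sdiff_of_subset hTS]
      · have := Finset.card_le_card hTS
        omega
      · intro e
        rw [Finset.mem_sdiff, ← hS e]
        simp only [List.mem_cons, exists_eq_or_imp]
        constructor
        · rintro ⟨T', hT', he⟩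
          exact ⟨Or.inr ⟨T', hT', he⟩, fun h => Finset.disjoint_left.1 (hp.1 T' hT') h he⟩
        · rintro ⟨h1 | h1, h2⟩
          exacts [absurd h1 h2, h1]
  exact key _ (I.pref_disjoint a) _ fun e => by rw [I.pref_cover, mem_contracts]

theorem length_prefList_le (I : SMTILC W F E) (a : W ⊕ F) :
    (I.prefList a).length ≤ Fintype.card E := by
  refine le_trans ?_ (((I.sum_card_prefList a).le).trans (Finset.card_le_univ _))
  have h : ∀ x ∈ (I.prefList a).map Finset.card, 1 ≤ x := by
    simp only [List.mem_map, forall_exists_index, and_imp, forall_apply_eq_imp_iff₂]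
    exact fun T hT => Finset.card_pos.2 (I.pref_nonempty a T hT)
  simpa using List.card_nsmul_le_sum _ 1 h

/-- The rank of a copy of a contract in a tie of index `t`: the copies with `u = 0` and then the
copies with `u = 1` are ranked tie by tie, followed by all copies with `u = 2`. -/
def level (N t u : ℕ) : ℕ := t + t + u + if u = 2 then N + N else 0

theorem level_mono {N t u v : ℕ} (huv : u ≤ v) (hv : v ≤ 2) : level N t u ≤ level N t v := by
  unfold level
  split_ifs <;> omega

/-- The rank which its worker assigns to the copy number `l` of `e`. -/
def workerLevel (I : SMTILC W F E) (e : E) (l : ℕ) : ℕ :=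
  level (Fintype.card E) (I.tieIndex (Sum.inl (I.worker e)) e) l

/-- The rank which its firm assigns to the copy number `l` of `e`. -/
def firmLevel (I : SMTILC W F E) (e : E) (l : ℕ) : ℕ :=
  level (Fintype.card E) (I.tieIndex (Sum.inr (I.firm e)) e) (2 - l)

theorem mem_contracts_worker (I : SMTILC W F E) (e : E) :
    e ∈ I.contracts (Sum.inl (I.worker e)) := mem_contracts.2 (Or.inl rfl)

theorem mem_contracts_firm (I : SMTILC W F E) (e : E) :
    e ∈ I.contracts (Sum.inr (I.firm e)) := mem_contracts.2 (Or.inr rfl)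

theorem tieIndex_lt {I : SMTILC W F E} {a : W ⊕ F} {e : E} (he : e ∈ I.contracts a) :
    I.tieIndex a e < Fintype.card E :=
  (tieIndex_lt_length he).trans_le (I.length_prefList_le a)

/-- The matching `M` with the copy number `st e` of each `e ∈ M` leaves no copy of another contract
free for both its agents. -/
structure IsCertified (I : SMTILC W F E) (M : Finset E) (st : E → ℕ) : Prop where
  isMatching : I.IsMatching M
  label : ∀ e ∈ M, st e < 3
  saturated : ∀ e, e ∉ M → ∀ l < 3,
    I.Saturated (Sum.inl (I.worker e)) M (fun m => I.workerLevel m (st m)) e (I.workerLevel e l) ∨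
    I.Saturated (Sum.inr (I.firm e)) M (fun m => I.firmLevel m (st m)) e (I.firmLevel e l)

theorem IsCertified.isStable {I : SMTILC W F E} {M : Finset E} {st : E → ℕ}
    (h : I.IsCertified M st) : I.IsStable M := by
  refine ⟨h.isMatching, ?_⟩
  rintro e ⟨he, hw, hf⟩
  rcases h.saturated e he 1 (by norm_num) with hs | hs
  · rcases free_iff.1 hw with h1 | ⟨e', he', hp, h1⟩
    · exact not_feasible_insert hs.noRoom he h1
    · rw [Finset.mem_inter] at he'
      have h2 := hs.rank_le he he'.1 h1
      have h3 := hp.tieIndex_lt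
      have h4 : I.worker e' = I.worker e := by simpa [mem_contracts, eq_comm] using he'.2
      simp only [workerLevel, level, h4] at h2
      split_ifs at h2 <;> omega
  · rcases free_iff.1 hf with h1 | ⟨e', he', hp, h1⟩
    · exact not_feasible_insert hs.noRoom he h1
    · rw [Finset.mem_inter] at he'
      have h2 := hs.rank_le he he'.1 h1
      have h3 := hp.tieIndex_lt
      have h4 : I.firm e' = I.firm e := by simpa [mem_contracts, eq_comm] using he'.2
      simp only [firmLevel, level, h4] at h2
      split_ifs at h2 <;> omega

theorem IsCertified.two_mul_card_le {I : SMTILC W F E} {M N : Finset E} {st : E → ℕ}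
    (h : I.IsCertified M st) (hN : I.IsStable N) : 2 * N.card ≤ 3 * M.card := by
  have hMs := h.isStable
  obtain ⟨P, hP, hPS, hP1, hP2, hPx, hPf⟩ := exists_exchange_pairing (I.owns_worker.isLaminar)
    (side_indep_iff.2 fun x => h.isMatching (Sum.inl x))
    (side_indep_iff.2 fun x => hN.1 (Sum.inl x))
  obtain ⟨Q, hQ, hQS, hQ1, hQ2, hQx, hQf⟩ := exists_exchange_pairing (I.owns_firm.isLaminar)
    (side_indep_iff.2 fun x => h.isMatching (Sum.inr x))
    (side_indep_iff.2 fun x => hN.1 (Sum.inr x))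
  have hcover : ∀ a ∈ N \ M, a ∈ P.image Prod.fst ∨ a ∈ Q.image Prod.fst := by
    intro a ha
    by_contra hcon
    rw [not_or] at hcon
    exact hMs.2 a ⟨(Finset.mem_sdiff.1 ha).2,
      free_iff.2 (Or.inl (side_indep_iff.1 (hPf a ha hcon.1) _)),
      free_iff.2 (Or.inl (side_indep_iff.1 (hQf a ha hcon.2) _))⟩
  set P' := P.filter fun p => p.1 ∉ Q.image Prod.fst with hP'
  set Q' := Q.filter fun p => p.1 ∉ P.image Prod.fst with hQ'
  have hdisj : Disjoint (P'.image Prod.snd) (Q'.image Prod.snd) := by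
    rw [Finset.disjoint_left]
    intro b hb1 hb2
    obtain ⟨⟨a1, b1⟩, hp, rfl⟩ := Finset.mem_image.1 hb1
    obtain ⟨⟨a2, b2⟩, hq, hbb⟩ := Finset.mem_image.1 hb2
    simp only at hbb
    subst hbb
    simp only [hP', hQ', Finset.mem_filter] at hp hq
    obtain ⟨hp, hp'⟩ := hp
    obtain ⟨hq, hq'⟩ := hq
    obtain ⟨ha1, hb⟩ := hP _ hp
    obtain ⟨ha2, -⟩ := hQ _ hq
    simp only at ha1 ha2 hb
    obtain ⟨⟨⟨w, L⟩, hL⟩, haL, hbL⟩ := hPS _ hp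
    have hw1 := I.owns_worker.eq_of_mem hL haL
    have hw2 := I.owns_worker.eq_of_mem hL hbL
    obtain ⟨⟨⟨f, L'⟩, hL'⟩, haL', hbL'⟩ := hQS _ hq
    have hf1 := I.owns_firm.eq_of_mem hL' haL'
    have hf2 := I.owns_firm.eq_of_mem hL' hbL'
    simp only at hw1 hw2 hf1 hf2
    subst hw1 hf1
    rw [Finset.mem_sdiff] at ha1 ha2 hb
    have hfa1 := side_indep_iff.1 (hQf a1 (Finset.mem_sdiff.2 ha1) hp') (I.firm a1)
    have hwa2 := side_indep_iff.1 (hPf a2 (Finset.mem_sdiff.2 ha2) hq') (I.worker a2)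
    have hw : ∀ l < 3, I.workerLevel b2 (st b2) ≤ I.workerLevel a1 l := by
      intro l hl
      rcases h.saturated a1 ha1.2 l hl with hs | hs
      · exact hs.rank_le ha1.2 hb.1 (side_indep_iff.1 (hPx _ hp).1 _)
      · exact absurd hfa1 (not_feasible_insert hs.noRoom ha1.2)
    have hf : ∀ l < 3, I.firmLevel b2 (st b2) ≤ I.firmLevel a2 l := by
      intro l hl
      rcases h.saturated a2 ha2.2 l hl with hs | hs
      · exact absurd hwa2 (not_feasible_insert hs.noRoom ha2.2)
      · exact hs.rank_le ha2.2 hb.1 (side_indep_iff.1 (hQx _ hq).1 _)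
    have hst := h.label b2 hb.1
    have hst' : st b2 = 0 ∨ st b2 = 1 ∨ st b2 = 2 := by omega
    have hta1 := tieIndex_lt (I.mem_contracts_worker a1)
    have hta2 := tieIndex_lt (I.mem_contracts_firm a2)
    have hw0 := hw 0 (by norm_num)
    have hw1 := hw 1 (by norm_num)
    have hf2' := hf 2 (by norm_num)
    have hf1' := hf 1 (by norm_num)
    simp only [workerLevel, firmLevel, level, hw2, hf2] at hw0 hw1 hf1' hf2'
    refine hN.2 b2 ⟨hb.2, free_iff.2 (Or.inr ⟨a1, ?_, ?_, ?_⟩),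
      free_iff.2 (Or.inr ⟨a2, ?_, ?_, ?_⟩)⟩
    · exact Finset.mem_inter.2 ⟨ha1.1, mem_contracts.2 (by rw [hw2]; exact Or.inl rfl)⟩
    · refine prefers_of_tieIndex_lt (I.mem_contracts_worker b2)
        (mem_contracts.2 (by rw [hw2]; exact Or.inl rfl)) ?_
      rw [hw2]
      rcases hst' with h0 | h0 | h0 <;> simp [h0] at hw0 hw1 hf1' hf2' <;> omega
    · exact side_indep_iff.1 (hPx _ hp).2 _
    · exact Finset.mem_inter.2 ⟨ha2.1, mem_contracts.2 (by rw [hf2]; exact Or.inr rfl)⟩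
    · refine prefers_of_tieIndex_lt (I.mem_contracts_firm b2)
        (mem_contracts.2 (by rw [hf2]; exact Or.inr rfl)) ?_
      rw [hf2]
      rcases hst' with h0 | h0 | h0 <;> simp [h0] at hw0 hw1 hf1' hf2' <;> omega
    · exact side_indep_iff.1 (hQx _ hq).2 _
  have hcard : ∀ {R : Finset (E × E)}, Set.InjOn Prod.snd (R : Set (E × E)) →
      (∀ p ∈ R, p.1 ∈ N \ M ∧ p.2 ∈ M \ N) → R.card ≤ (M \ N).card := by
    intro R h1 h2
    rw [← Finset.card_image_of_injOn h1]
    exact Finset.card_le_card (Finset.image_subset_iff.2 fun p hp => (h2 p hp).2)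
  have h1 := hcard hP2 hP
  have h2 := hcard hQ2 hQ
  have hP's : P' ⊆ P := Finset.filter_subset _ _
  have hQ's : Q' ⊆ Q := Finset.filter_subset _ _
  have h3 : P'.card + Q'.card ≤ (M \ N).card := by
    rw [← Finset.card_image_of_injOn (hP2.mono hP's), ← Finset.card_image_of_injOn (hQ2.mono hQ's),
      ← Finset.card_union_of_disjoint hdisj]
    refine Finset.card_le_card (Finset.union_subset ?_ ?_)
    · exact Finset.image_subset_iff.2 fun p hp => (hP p (hP's hp)).2
    · exact Finset.image_subset_iff.2 fun p hp => (hQ p (hQ's hp)).2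
  have h4 : (N \ M).card ≤ P.card + Q'.card := by
    refine (Finset.card_le_card (t := P.image Prod.fst ∪ Q'.image Prod.fst) fun a ha => ?_).trans
      ((Finset.card_union_le _ _).trans (add_le_add Finset.card_image_le Finset.card_image_le))
    by_cases haP : a ∈ P.image Prod.fst
    · exact Finset.mem_union_left _ haP
    · obtain ⟨q, hq, rfl⟩ := Finset.mem_image.1 ((hcover a ha).resolve_left haP)
      exact Finset.mem_union_right _ (Finset.mem_image_of_mem _ (Finset.mem_filter.2 ⟨hq, haP⟩))
  have h5 : (N \ M).card ≤ Q.card + P'.card := by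
    refine (Finset.card_le_card (t := Q.image Prod.fst ∪ P'.image Prod.fst) fun a ha => ?_).trans
      ((Finset.card_union_le _ _).trans (add_le_add Finset.card_image_le Finset.card_image_le))
    by_cases haQ : a ∈ Q.image Prod.fst
    · exact Finset.mem_union_left _ haQ
    · obtain ⟨q, hq, rfl⟩ := Finset.mem_image.1 ((hcover a ha).resolve_right haQ)
      exact Finset.mem_union_right _ (Finset.mem_image_of_mem _ (Finset.mem_filter.2 ⟨hq, haQ⟩))
  have h6 := Finset.card_sdiff_add_card_inter M N
  have h7 := Finset.card_sdiff_add_card_inter N M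
  rw [Finset.inter_comm] at h7
  omega

end SMTILC

/-! ## Proposals -/

namespace SMTILC

set_option linter.unusedSectionVars false

open Laminar

variable {W F E : Type*} [Fintype W] [Fintype F] [Fintype E]
  [DecidableEq W] [DecidableEq F] [DecidableEq E]

/-- The invariant of the proposal algorithm: `M` is the current matching, and `st e` is the number
of copies of `e` which its firm has rejected. -/
structure Invariant (I : SMTILC W F E) (M : Finset E) (st : E → ℕ) : Prop where
  label_le : ∀ e, st e ≤ 3
  label_lt : ∀ e ∈ M, st e < 3
  firm_indep : Indep (I.sideSet Sum.inr) (I.sideQuota Sum.inr) M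
  worker : ∃ X, Indep (I.sideSet Sum.inl) (I.sideQuota Sum.inl) X ∧ M ⊆ X ∧ (∀ e ∈ X, st e < 3) ∧
    ∀ e, e ∉ X → st e < 3 → Dominated (I.sideSet Sum.inl) (I.sideQuota Sum.inl) X
      (fun m => I.workerLevel m (st m)) e (I.workerLevel e (st e))
  firm : ∀ e, e ∉ M → 0 < st e → Dominated (I.sideSet Sum.inr) (I.sideQuota Sum.inr) M
      (fun m => I.firmLevel m (st m)) e (I.firmLevel e (st e - 1))

/-- The contract `f` can be proposed by its worker. -/
def Proposable (I : SMTILC W F E) (M : Finset E) (st : E → ℕ) (f : E) : Prop :=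
  f ∉ M ∧ st f < 3 ∧ ¬ I.NoRoom (Sum.inl (I.worker f)) M f

/-- The contract `f` is a best one among those which can be proposed. -/
def BestProposable (I : SMTILC W F E) (M : Finset E) (st : E → ℕ) (f : E) : Prop :=
  I.Proposable M st f ∧
    ∀ g, I.Proposable M st g → I.workerLevel f (st f) ≤ I.workerLevel g (st g)

theorem invariant_init (I : SMTILC W F E) : I.Invariant ∅ fun _ => 0 := by
  obtain ⟨X, hX, hdom⟩ := exists_dominating (I.sideSet Sum.inl) (I.sideQuota Sum.inl)
    fun m => I.workerLevel m 0
  exact ⟨by simp, by simp, fun i => by simp,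
    ⟨X, hX, by simp, by simp, fun e he _ => hdom e he⟩, by simp⟩

theorem Invariant.isCertified {I : SMTILC W F E} {M : Finset E} {st : E → ℕ}
    (h : I.Invariant M st) (hno : ∀ f, ¬ I.Proposable M st f) : I.IsCertified M st := by
  obtain ⟨X, hX, hMX, hXst, hdom⟩ := h.worker
  have hXM : X = M := by
    refine Finset.Subset.antisymm (fun f hf => ?_) hMX
    by_contra hfM
    exact hno f ⟨hfM, hXst f hf, fun hn => not_full_of_indep_insert hfM
      (hX.mono (Finset.insert_subset hf hMX)) (I.owns_worker.full_iff.2 hn)⟩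
  subst hXM
  refine ⟨?_, hXst, fun e he l hl => ?_⟩
  · rintro (w | f)
    · exact side_indep_iff.1 hX w
    · exact side_indep_iff.1 h.firm_indep f
  · by_cases hle : l < st e
    · right
      rw [← I.owns_firm.dominated_iff]
      exact (h.firm e he (by omega)).mono (level_mono (by omega) (by omega))
    · left
      rw [← I.owns_worker.dominated_iff]
      exact (hdom e he (by omega)).mono (level_mono (by omega) (by omega))

theorem Invariant.exists_worker_insert {I : SMTILC W F E} {M : Finset E} {st : E → ℕ} {f : E}
    (h : I.Invariant M st) (hf : I.BestProposable M st f) :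
    ∃ X, Indep (I.sideSet Sum.inl) (I.sideQuota Sum.inl) X ∧ insert f M ⊆ X ∧
      (∀ e ∈ X, st e < 3) ∧
      ∀ e, e ∉ X → st e < 3 → Dominated (I.sideSet Sum.inl) (I.sideQuota Sum.inl) X
        (fun m => I.workerLevel m (st m)) e (I.workerLevel e (st e)) := by
  obtain ⟨X, hX, hMX, hXst, hdom⟩ := h.worker
  obtain ⟨⟨hfM, hfst, hfr⟩, hbest⟩ := hf
  exact exists_dominating_insert (I.owns_worker.isLaminar) (ρ := fun m => I.workerLevel m (st m))
    (avail := fun e => st e < 3) hX hMX hXst hdom (I.owns_worker.full_iff.not.2 hfr) hfM hfst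
    fun g hg hgst hgf => hbest g ⟨hg, hgst, I.owns_worker.full_iff.not.1 hgf⟩

/-- A proposal which the firm accepts. -/
theorem Invariant.accept {I : SMTILC W F E} {M : Finset E} {st : E → ℕ} {f : E}
    (h : I.Invariant M st) (hf : I.BestProposable M st f)
    (hroom : ¬ I.NoRoom (Sum.inr (I.firm f)) M f) : I.Invariant (insert f M) st := by
  have hroom' := I.owns_firm.full_iff.not.2 hroom
  refine ⟨h.label_le, ?_, indep_insert h.firm_indep hroom', h.exists_worker_insert hf, ?_⟩
  · intro e he
    rcases Finset.mem_insert.1 he with rfl | he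
    exacts [hf.1.2.1, h.label_lt e he]
  · intro e he hst
    exact (h.firm e (fun h => he (Finset.mem_insert_of_mem h)) hst).insert hroom'

/-- A proposal upon which the firm rejects the worst contract `r` of the smallest full set. -/
theorem Invariant.reject {I : SMTILC W F E} {M : Finset E} {st : E → ℕ} {f r : E}
    (h : I.Invariant M st) (hf : I.BestProposable M st f) {L : Finset E}
    (hL : L ∈ I.lam (Sum.inr (I.firm f))) (hfL : f ∈ L)
    (hq : I.quota (Sum.inr (I.firm f)) L ≤ (M ∩ L).card)
    (hmin : ∀ L' ∈ I.lam (Sum.inr (I.firm f)), f ∈ L' →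
      I.quota (Sum.inr (I.firm f)) L' ≤ (M ∩ L').card → L.card ≤ L'.card)
    (hr : r ∈ insert f (M ∩ L))
    (hmax : ∀ m ∈ insert f (M ∩ L), I.firmLevel m (st m) ≤ I.firmLevel r (st r)) :
    I.Invariant ((insert f M).erase r) (Function.update st r (st r + 1)) := by
  have hrM : r ∈ insert f M := by
    rcases Finset.mem_insert.1 hr with rfl | hr
    exacts [Finset.mem_insert_self _ _, Finset.mem_insert_of_mem (Finset.mem_inter.1 hr).1]
  have hlt : ∀ e ∈ insert f M, st e < 3 := by
    intro e he
    rcases Finset.mem_insert.1 he with rfl | he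
    exacts [hf.1.2.1, h.label_lt e he]
  have hst : ∀ e, e ≠ r → Function.update st r (st r + 1) e = st e := fun e he => by simp [he]
  have hstM : ∀ e ∈ (insert f M).erase r, Function.update st r (st r + 1) e = st e := fun e he =>
    hst e (Finset.mem_erase.1 he).1
  obtain ⟨X, hX, hMX, hXst, hdom⟩ := h.exists_worker_insert hf
  obtain ⟨h1, h2, h3⟩ := exchange (I.owns_firm.isLaminar) (i := ⟨⟨I.firm f, L⟩, hL⟩)
    (ρ := fun m => I.firmLevel m (st m)) h.firm_indep hf.1.1 hfL hq (by
      rintro ⟨⟨x, L'⟩, hL'⟩ hfL' hq'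
      obtain rfl := I.owns_firm.eq_of_mem hL' hfL'
      exact hmin L' hL' hfL' hq') hr hmax
  refine ⟨fun e => ?_, fun e he => ?_, h1, ?_, fun e he hste => ?_⟩
  · by_cases her : e = r
    · subst her
      rw [Function.update_self]
      exact hlt e hrM
    · rw [hst e her]
      exact h.label_le e
  · rw [hstM e he]
    exact hlt e (Finset.mem_of_mem_erase he)
  · obtain ⟨X', hX', hXX', hav, hd⟩ := exists_dominating_of_worse (I.owns_worker.isLaminar)
      (ρ := fun m => I.workerLevel m (st m))
      (ρ' := fun m => I.workerLevel m (Function.update st r (st r + 1) m))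
      (avail := fun e => st e < 3)
      (avail' := fun e => Function.update st r (st r + 1) e < 3)
      (r := r) hX (hMX hrM) (fun e he => by simp only [hst e he])
      (fun e he => by simp only [hst e he]) hXst hdom
    exact ⟨X', hX', (Finset.erase_subset_erase r hMX).trans hXX', hav, hd⟩
  · by_cases her : e = r
    · subst her
      rw [Function.update_self, Nat.add_sub_cancel]
      exact h3.congr fun m hm => by simp only [hstM m hm]
    · rw [hst e her] at hste ⊢
      refine (h2 e _ (h.firm e (fun heM => he ?_) hste)).congr fun m hm => by simp only [hstM m hm]
      exact Finset.mem_erase.2 ⟨her, Finset.mem_insert_of_mem heM⟩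

/-- A quantity which every proposal increases. -/
def progress (M : Finset E) (st : E → ℕ) : ℕ := 2 * ∑ e, st e + M.card

theorem Invariant.progress_le {I : SMTILC W F E} {M : Finset E} {st : E → ℕ}
    (h : I.Invariant M st) : progress M st ≤ 7 * Fintype.card E := by
  have h1 : ∑ e, st e ≤ ∑ _e : E, 3 := Finset.sum_le_sum fun e _ => h.label_le e
  have h2 := M.card_le_univ
  simp only [Finset.sum_const, Finset.card_univ, smul_eq_mul] at h1
  unfold progress
  omega

theorem progress_insert {M : Finset E} {st : E → ℕ} {f : E} (hf : f ∉ M) :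
    progress (insert f M) st = progress M st + 1 := by
  simp [progress, Finset.card_insert_of_notMem hf, add_assoc]

theorem progress_reject {M : Finset E} {st : E → ℕ} {f r : E} (hf : f ∉ M) (hr : r ∈ insert f M) :
    progress M st < progress ((insert f M).erase r) (Function.update st r (st r + 1)) := by
  have h1 : ∑ e, Function.update st r (st r + 1) e = ∑ e, st e + 1 := by
    rw [Finset.sum_update_of_mem (Finset.mem_univ r), ← Finset.add_sum_erase _ st
      (Finset.mem_univ r), Finset.sdiff_singleton_eq_erase]
    omega
  unfold progress
  rw [h1, Finset.card_erase_of_mem hr, Finset.card_insert_of_notMem hf]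
  omega

end SMTILC

/-! ## Reasoning about programs -/

namespace RAM

/-- Started in `s`, the program `p` halts, and the number of steps and the final state
satisfy `Q`. -/
def WP (p : Prog) (s : State) (Q : ℕ → State → Prop) : Prop :=
  ∃ t s', Exec p s t s' ∧ Q t s'

theorem WP.mono {p : Prog} {s : State} {Q Q' : ℕ → State → Prop} (h : WP p s Q)
    (hQ : ∀ t s', Q t s' → Q' t s') : WP p s Q' :=
  let ⟨t, s', h1, h2⟩ := h
  ⟨t, s', h1, hQ t s' h2⟩

theorem wp_skip {s : State} {Q : ℕ → State → Prop} : WP Prog.skip s Q ↔ Q 1 s :=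
  ⟨fun ⟨_, _, h, hQ⟩ => by cases h; exact hQ, fun h => ⟨_, _, Exec.skip s, h⟩⟩

theorem wp_setReg {s : State} {x : ℕ} {e : Expr} {Q : ℕ → State → Prop} :
    WP (Prog.setReg x e) s Q ↔ Q (e.cost + 1) ⟨Function.update s.reg x (e.eval s), s.arr⟩ :=
  ⟨fun ⟨_, _, h, hQ⟩ => by cases h; exact hQ, fun h => ⟨_, _, Exec.setReg s x e, h⟩⟩

theorem wp_setArr {s : State} {b : ℕ} {i e : Expr} {Q : ℕ → State → Prop} :
    WP (Prog.setArr b i e) s Q ↔ Q (i.cost + e.cost + 1) ⟨s.reg, Function.update s.arr b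
      (Function.update (s.arr b) (i.eval s) (e.eval s))⟩ :=
  ⟨fun ⟨_, _, h, hQ⟩ => by cases h; exact hQ, fun h => ⟨_, _, Exec.setArr s b i e, h⟩⟩

theorem wp_seq {p q : Prog} {s : State} {Q : ℕ → State → Prop} :
    WP (Prog.seq p q) s Q ↔ WP p s fun t₁ s₁ => WP q s₁ fun t₂ s₂ => Q (t₁ + t₂) s₂ := by
  constructor
  · rintro ⟨_, _, h, hQ⟩
    cases h with
    | seq h1 h2 => exact ⟨_, _, h1, _, _, h2, hQ⟩
  · rintro ⟨_, _, h1, _, _, h2, hQ⟩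
    exact ⟨_, _, Exec.seq h1 h2, hQ⟩

theorem wp_ite {e : Expr} {p q : Prog} {s : State} {Q : ℕ → State → Prop} :
    WP (Prog.ite e p q) s Q ↔
      (e.eval s ≠ 0 → WP p s fun t s' => Q (e.cost + 1 + t) s') ∧
      (e.eval s = 0 → WP q s fun t s' => Q (e.cost + 1 + t) s') := by
  constructor
  · rintro ⟨_, _, h, hQ⟩
    cases h with
    | ite_true he h => exact ⟨fun _ => ⟨_, _, h, hQ⟩, fun he' => absurd he' he⟩
    | ite_false he h => exact ⟨fun he' => absurd he he', fun _ => ⟨_, _, h, hQ⟩⟩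
  · rintro ⟨h1, h2⟩
    by_cases he : e.eval s = 0
    · obtain ⟨_, _, h, hQ⟩ := h2 he
      exact ⟨_, _, Exec.ite_false he h, hQ⟩
    · obtain ⟨_, _, h, hQ⟩ := h1 he
      exact ⟨_, _, Exec.ite_true he h, hQ⟩

/-- The registers to which a program assigns. -/
def Prog.regs : Prog → List ℕ
  | skip => []
  | setReg x _ => [x]
  | setArr _ _ _ => []
  | seq p q => p.regs ++ q.regs
  | ite _ p q => p.regs ++ q.regs
  | loop _ p => p.regs

/-- The arrays to which a program assigns. -/
def Prog.arrs : Prog → List ℕ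
  | skip => []
  | setReg _ _ => []
  | setArr b _ _ => [b]
  | seq p q => p.arrs ++ q.arrs
  | ite _ p q => p.arrs ++ q.arrs
  | loop _ p => p.arrs

/-- The states `s` and `s'` differ only in registers and arrays to which `p` assigns. -/
def Same (p : Prog) (s s' : State) : Prop :=
  (∀ x, x ∉ p.regs → s'.reg x = s.reg x) ∧ ∀ b, b ∉ p.arrs → s'.arr b = s.arr b

theorem Same.refl (p : Prog) (s : State) : Same p s s := ⟨fun _ _ => rfl, fun _ _ => rfl⟩

theorem Same.trans {p : Prog} {s₁ s₂ s₃ : State} (h : Same p s₁ s₂) (h' : Same p s₂ s₃) :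
    Same p s₁ s₃ :=
  ⟨fun x hx => (h'.1 x hx).trans (h.1 x hx), fun b hb => (h'.2 b hb).trans (h.2 b hb)⟩

theorem Exec.same {p : Prog} {s s' : State} {t : ℕ} (h : Exec p s t s') : Same p s s' := by
  induction h with
  | skip | loop_stop => exact Same.refl _ _
  | setReg s x e =>
    refine ⟨fun y hy => ?_, fun b _ => rfl⟩
    simp only [Prog.regs, List.mem_singleton] at hy
    simp [hy]
  | setArr s b i e =>
    refine ⟨fun y _ => rfl, fun c hc => ?_⟩
    simp only [Prog.arrs, List.mem_singleton] at hc
    simp [hc]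
  | seq _ _ ih₁ ih₂ =>
    refine ⟨fun x hx => ?_, fun b hb => ?_⟩
    · simp only [Prog.regs, List.mem_append, not_or] at hx
      exact (ih₂.1 x hx.2).trans (ih₁.1 x hx.1)
    · simp only [Prog.arrs, List.mem_append, not_or] at hb
      exact (ih₂.2 b hb.2).trans (ih₁.2 b hb.1)
  | ite_true _ _ ih =>
    refine ⟨fun x hx => ih.1 x fun h => hx ?_, fun b hb => ih.2 b fun h => hb ?_⟩
    exacts [List.mem_append_left _ h, List.mem_append_left _ h]
  | ite_false _ _ ih =>
    refine ⟨fun x hx => ih.1 x fun h => hx ?_, fun b hb => ih.2 b fun h => hb ?_⟩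
    exacts [List.mem_append_right _ h, List.mem_append_right _ h]
  | loop_step _ _ _ ih₁ ih₂ => exact Same.trans (p := Prog.loop _ _) ih₁ ih₂

theorem WP.same {p : Prog} {s : State} {Q : ℕ → State → Prop} (h : WP p s Q) :
    WP p s fun t s' => Same p s s' ∧ Q t s' :=
  let ⟨t, s', h1, h2⟩ := h
  ⟨t, s', h1, h1.same, h2⟩

/-- A loop whose invariant depends on an index and whose remaining running time is bounded by a
function of this index. -/
theorem wp_loop {β : Type*} {e : Expr} {p : Prog} (Inv : β → State → Prop) (pot : β → ℕ)
    {s₀ : State} {b₀ : β} (h₀ : Inv b₀ s₀)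
    (hstep : ∀ b s, Same p s₀ s → Inv b s → e.eval s ≠ 0 →
      WP p s fun t s' => ∃ b', t + (e.cost + 1) + pot b' ≤ pot b ∧ Inv b' s') :
    WP (Prog.loop e p) s₀ fun t s' => t ≤ pot b₀ + (e.cost + 1) ∧ Same p s₀ s' ∧ e.eval s' = 0 ∧
      ∃ b, Inv b s' := by
  suffices h : ∀ k b s, pot b = k → Same p s₀ s → Inv b s → WP (Prog.loop e p) s fun t s' =>
      t ≤ pot b + (e.cost + 1) ∧ Same p s₀ s' ∧ e.eval s' = 0 ∧ ∃ b, Inv b s' from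
    h _ b₀ s₀ rfl (Same.refl _ _) h₀
  intro k
  induction k using Nat.strong_induction_on with
  | _ k ih =>
    intro b s hk hs hb
    by_cases he : e.eval s = 0
    · exact ⟨_, _, Exec.loop_stop he, by omega, hs, he, b, hb⟩
    · obtain ⟨t, s', h1, b', ht, hb'⟩ := hstep b s hs hb he
      obtain ⟨t', s'', h2, ht', h3⟩ := ih (pot b') (by omega) b' s' rfl (hs.trans h1.same) hb'
      exact ⟨_, _, Exec.loop_step he h1 h2, by omega, h3⟩

end RAM

namespace SMTILC

theorem stored_nil {m : ℕ → ℕ} {p : ℕ} : Stored m p [] := fun i hi => by simp at hi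

theorem stored_cons {m : ℕ → ℕ} {p x : ℕ} {l : List ℕ} :
    Stored m p (x :: l) ↔ m p = x ∧ Stored m (p + 1) l := by
  constructor
  · intro h
    refine ⟨h 0 (by simp), fun i hi => ?_⟩
    have := h (i + 1) (by simpa using hi)
    rw [show p + 1 + i = p + (i + 1) by omega, this]
    rfl
  · rintro ⟨rfl, h⟩ (_ | i) hi
    · rfl
    · have := h i (by simpa using hi)
      rw [show p + (i + 1) = p + 1 + i by omega, this]
      rfl

theorem stored_append {m : ℕ → ℕ} {l l' : List ℕ} {p : ℕ} :
    Stored m p (l ++ l') ↔ Stored m p l ∧ Stored m (p + l.length) l' := by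
  induction l generalizing p with
  | nil => simp [stored_nil]
  | cons x l ih =>
    rw [List.cons_append, stored_cons, stored_cons, ih, List.length_cons, and_assoc,
      show p + 1 + l.length = p + (l.length + 1) by omega]

end SMTILC

/-! ## Parts of the program -/

namespace RAM

open SMTILC

/-- `x += e` -/
def Prog.incr (x : ℕ) (e : Expr) : Prog := Prog.setReg x (Expr.add (Expr.reg x) e)

/-- `x -= 1` -/
def Prog.decr (x : ℕ) : Prog := Prog.setReg x (Expr.sub (Expr.reg x) (Expr.lit 1))

/-- Writes to the cells of the array `b` given by the list of length `r6` at the address `r3` of the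
array `c` the value of `v`. -/
def fillProg (c b : ℕ) (v : Expr) : Prog :=
  Prog.loop (Expr.reg 6)
    (Prog.seq (Prog.setArr b (Expr.get c (Expr.reg 3)) v)
    (Prog.seq (Prog.incr 3 (Expr.lit 1)) (Prog.decr 6)))

theorem wp_fillProg {c b : ℕ} (hcb : c ≠ b) {v : Expr} (hv : v = Expr.lit 1 ∨ v = Expr.reg 5)
    {s : State} {l : List ℕ}
    (hl : Stored (s.arr c) (s.reg 3) l) (h6 : s.reg 6 = l.length) :
    WP (fillProg c b v) s fun t s' => t ≤ 15 * l.length + 2 ∧ s'.reg 3 = s.reg 3 + l.length ∧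
      ∀ e, s'.arr b e = if e ∈ l then v.eval s else s.arr b e := by
  have hvc : v.cost = 1 := by rcases hv with rfl | rfl <;> rfl
  refine (wp_loop (fun (k : List ℕ) s' => Stored (s.arr c) (s'.reg 3) k ∧ s'.reg 6 = k.length ∧
    s'.reg 3 + k.length = s.reg 3 + l.length ∧ (∀ e ∈ k, e ∈ l) ∧
    ∀ e, e ∉ k → s'.arr b e = if e ∈ l then v.eval s else s.arr b e)
    (fun k => 15 * k.length) ⟨hl, h6, rfl, fun e he => he, fun e he => by simp [he]⟩ ?_).mono ?_
  · rintro (_ | ⟨x, k⟩) s' hs ⟨h1, h2, h3, h4, h5⟩ he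
    · exact absurd h2 he
    · rw [stored_cons] at h1
      have hc : s'.arr c = s.arr c := hs.2 c (by simpa [Prog.arrs, Prog.incr, Prog.decr] using hcb)
      have hve : v.eval s' = v.eval s := by
        rcases hv with rfl | rfl
        · rfl
        · exact hs.1 5 (by simp [Prog.regs, Prog.incr, Prog.decr])
      simp only [wp_seq, wp_setReg, wp_setArr, Prog.incr, Prog.decr]
      refine ⟨k, ?_, ?_⟩
      · simp [Expr.cost, hvc]
        omega
      · simp only [Expr.eval, Function.update_apply]
        simp [hc, h1.1, h2, hve]
        refine ⟨h1.2, ?_, ?_, ?_⟩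
        · simp at h3; omega
        · exact fun e he => h4 e (List.mem_cons_of_mem _ he)
        · intro e he
          by_cases hex : e = x
          · subst hex
            simp [h4 e]
          · simp [hex]
            exact h5 e (by simp [he, hex])
  · rintro t s' ⟨ht, hs, he, k, h1, h2, h3, h4, h5⟩
    have hk : k = [] := List.eq_nil_of_length_eq_zero (h2.symm.trans he)
    subst hk
    exact ⟨ht, h3, fun e => h5 e (by simp)⟩

/-- Writes to the cells of the array `b` given by the preference record at the address `r3` the
number of the tie which contains them. -/
def prefProg (b : ℕ) : Prog :=
  Prog.seq (Prog.setReg 4 (Expr.get 4 (Expr.reg 3)))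
  (Prog.seq (Prog.incr 3 (Expr.lit 1))
  (Prog.seq (Prog.setReg 5 (Expr.lit 0))
  (Prog.loop (Expr.sub (Expr.reg 4) (Expr.reg 5))
    (Prog.seq (Prog.setReg 6 (Expr.get 4 (Expr.reg 3)))
    (Prog.seq (Prog.incr 3 (Expr.lit 1))
    (Prog.seq (fillProg 4 b (Expr.reg 5))
    (Prog.incr 5 (Expr.lit 1))))))))

theorem wp_prefProg {b : ℕ} (hb : 4 ≠ b) {s : State} {ties : List (List ℕ)} {G : ℕ → ℕ}
    (hG : ∀ i (hi : i < ties.length), ∀ e ∈ ties[i], G e = i)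
    (hr : Stored (s.arr 4) (s.reg 3)
      (ties.length :: ties.flatMap fun l => l.length :: l)) :
    WP (prefProg b) s fun t s' =>
      t ≤ 30 * (ties.length :: ties.flatMap fun l => l.length :: l).length ∧
      ∀ e, s'.arr b e = if e ∈ ties.flatten then G e else s.arr b e := by
  rw [stored_cons] at hr
  simp only [prefProg, wp_seq, wp_setReg, Prog.incr]
  refine WP.mono (wp_loop (fun (i : ℕ) s' => i ≤ ties.length ∧ s'.reg 5 = i ∧
    s'.reg 4 = ties.length ∧
    Stored (s.arr 4) (s'.reg 3) ((ties.drop i).flatMap fun l => l.length :: l) ∧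
    ∀ e, e ∉ (ties.drop i).flatten → s'.arr b e = if e ∈ ties.flatten then G e else s.arr b e)
    (fun i => 23 * ((ties.drop i).flatMap fun l => l.length :: l).length) (b₀ := 0)
    ⟨Nat.zero_le _, ?_⟩ ?_) ?_
  · simp only [Expr.eval, Function.update_apply]
    simp only [reduceIte, Nat.reduceEqDiff, List.drop_zero, hr.1, hr.2,
      true_and]
    exact fun e he => (if_neg he).symm
  · rintro i s' hs ⟨h1, h2, h3, h4, h5⟩ he
    have hi : i < ties.length := by
      simp only [Expr.eval, h2, h3] at he
      omega
    have hd := List.drop_eq_getElem_cons hi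
    rw [hd] at h4 h5
    rw [List.flatMap_cons, List.cons_append, stored_cons, stored_append] at h4
    obtain ⟨h4, h6, h7⟩ := h4
    have hc : s'.arr 4 = s.arr 4 := hs.2 4
      (by simpa [Prog.arrs, Prog.incr, Prog.decr, fillProg] using hb)
    simp only [wp_seq, wp_setReg]
    refine WP.mono (WP.same (wp_fillProg hb (Or.inr rfl) (l := ties[i])
      (by simpa [Expr.eval, hc] using h6)
      (by simp [Expr.eval, hc, h4]))) ?_
    rintro t s2 ⟨hs2, ht, h8, h9⟩
    have e4 := hs2.1 4 (by simp [Prog.regs, Prog.incr, Prog.decr, fillProg])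
    have e5 := hs2.1 5 (by simp [Prog.regs, Prog.incr, Prog.decr, fillProg])
    simp [Expr.eval] at e4 e5 h8 h9
    refine ⟨i + 1, ?_, hi, ?_, ?_, ?_, ?_⟩
    · simp only [hd, List.flatMap_cons, List.length_append, List.length_cons, Expr.cost]
      omega
    · simp only [Expr.eval, Function.update_apply]
      simp [e5, h2]
    · simp [e4, h3]
    · simpa [h8] using h7
    · intro e he'
      rw [h9, h2]
      by_cases hei : e ∈ ties[i]
      · have : e ∈ ties.flatten := List.mem_flatten.2 ⟨_, List.getElem_mem hi, hei⟩
        rw [if_pos hei, if_pos this, hG i hi e hei]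
      · rw [if_neg hei]
        refine h5 e ?_
        rw [List.flatten_cons, List.mem_append, not_or]
        exact ⟨hei, he'⟩
  · rintro t s' ⟨ht, hs, he, i, h1, h2, h3, h4, h5⟩
    have hi : i = ties.length := by
      simp only [Expr.eval, h2, h3] at he
      omega
    subst hi
    refine ⟨?_, fun e => h5 e (by simp)⟩
    simp [Expr.cost] at ht ⊢
    omega

/-- An expression whose value is zero if and only if those of `e₁` and `e₂` are equal. -/
def Expr.dist (e₁ e₂ : Expr) : Expr := Expr.add (Expr.sub e₁ e₂) (Expr.sub e₂ e₁)

/-- Reads the member of a laminar family at the address `r3`: `r3` becomes the address and `r6` the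
length of its list of contracts, `r5` the part of the quota not used by the set in the array 6, and
`r7` becomes zero if and only if the contract `r10` is in the list. -/
def memberProg : Prog :=
  Prog.seq (Prog.setReg 5 (Expr.get 5 (Expr.reg 3)))
  (Prog.seq (Prog.incr 3 (Expr.lit 1))
  (Prog.seq (Prog.setReg 6 (Expr.get 5 (Expr.reg 3)))
  (Prog.seq (Prog.incr 3 (Expr.lit 1))
  (Prog.seq (Prog.setReg 7 (Expr.lit 1))
  (Prog.seq (Prog.setReg 8 (Expr.reg 3))
  (Prog.seq (Prog.setReg 9 (Expr.reg 6))
  (Prog.loop (Expr.reg 9)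
    (Prog.seq (Prog.setReg 5 (Expr.sub (Expr.reg 5) (Expr.get 6 (Expr.get 5 (Expr.reg 8)))))
    (Prog.seq (Prog.setReg 7 (Expr.sub (Expr.reg 7) (Expr.sub (Expr.lit 1)
      (Expr.dist (Expr.get 5 (Expr.reg 8)) (Expr.reg 10)))))
    (Prog.seq (Prog.incr 8 (Expr.lit 1)) (Prog.decr 9)))))))))))

theorem wp_memberProg {s : State} {q : ℕ} {l : List ℕ}
    (hl : Stored (s.arr 5) (s.reg 3) (q :: l.length :: l)) :
    WP memberProg s fun t s' => t ≤ 35 * l.length + 30 ∧ s'.reg 3 = s.reg 3 + 2 ∧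
      s'.reg 6 = l.length ∧ s'.reg 5 = q - (l.map (s.arr 6)).sum ∧
      (s'.reg 7 = 0 ↔ s.reg 10 ∈ l) := by
  rw [stored_cons, stored_cons] at hl
  simp only [memberProg, wp_seq, wp_setReg, Prog.incr, Prog.decr]
  refine WP.mono (wp_loop (fun (k : List ℕ) s' => s'.reg 9 = k.length ∧
    Stored (s.arr 5) (s'.reg 8) k ∧
    s'.reg 5 - (k.map (s.arr 6)).sum = q - (l.map (s.arr 6)).sum ∧
    (s'.reg 7 = 0 ∨ s.reg 10 ∈ k ↔ s.reg 10 ∈ l) ∧ s'.reg 7 ≤ 1)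
    (fun k => 35 * k.length) (b₀ := l) ?_ ?_) ?_
  · simp only [Expr.eval, Function.update_apply]
    simp [hl.1, hl.2.1, hl.2.2]
  · rintro (_ | ⟨x, k⟩) s' hs ⟨h1, h2, h3, h4, h5⟩ he
    · exact absurd h1 he
    have e5 := hs.2 5 (by simp [Prog.arrs])
    have e6 := hs.2 6 (by simp [Prog.arrs])
    have r10 := hs.1 10 (by simp [Prog.regs])
    simp at e5 e6 r10
    rw [stored_cons] at h2
    simp only [wp_seq, wp_setReg, Expr.dist]
    refine ⟨k, ?_, ?_, ?_, ?_, ?_, ?_⟩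
    · simp only [Expr.cost, List.length_cons]
      omega
    · simp [Expr.eval, h1]
    · simpa [Expr.eval, Function.update_apply] using h2.2
    · simp only [List.map_cons, List.sum_cons] at h3
      simp [Expr.eval, e5, e6, h2.1]
      omega
    · simp only [Expr.eval, Function.update_apply]
      simp only [reduceIte, Nat.reduceEqDiff, e5, h2.1, r10]
      rw [← h4, List.mem_cons]
      by_cases hx : s.reg 10 = x
      · subst hx
        simp
        omega
      · have : s'.reg 7 - (1 - (x - s.reg 10 + (s.reg 10 - x))) = s'.reg 7 := by omega
        rw [this]
        simp [hx]
    · simp [Expr.eval]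
      omega
  · rintro t s' ⟨ht, hs, he, k, h1, h2, h3, h4, h5⟩
    have hk : k = [] := List.eq_nil_of_length_eq_zero (h1.symm.trans he)
    subst hk
    have e3 := hs.1 3 (by simp [Prog.regs])
    have e6 := hs.1 6 (by simp [Prog.regs])
    simp [Expr.eval, hl.2.1] at e3 e6
    refine ⟨?_, e3, e6, by simpa using h3, by simpa using h4⟩
    simp only [Expr.cost] at ht ⊢
    omega

/-- Sets to 1 the cells of the array 8 given by the members without room of the laminar family at
the address `r3`. -/
def fullProg : Prog :=
  Prog.seq (Prog.setReg 4 (Expr.get 5 (Expr.reg 3)))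
  (Prog.seq (Prog.incr 3 (Expr.lit 1))
  (Prog.loop (Expr.reg 4)
    (Prog.seq memberProg
    (Prog.seq (Prog.ite (Expr.reg 5) (Prog.incr 3 (Expr.reg 6)) (fillProg 5 8 (Expr.lit 1)))
    (Prog.decr 4)))))

/-- The code of a laminar family. -/
def famCode (fam : List (ℕ × List ℕ)) : List ℕ := fam.flatMap fun m => m.1 :: m.2.length :: m.2

theorem wp_fullProg {s : State} {fam : List (ℕ × List ℕ)}
    (hr : Stored (s.arr 5) (s.reg 3) (fam.length :: famCode fam)) :
    WP fullProg s fun t s' => t ≤ 60 * (famCode fam).length + 15 ∧ ∀ e, s'.arr 8 e =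
      if ∃ m ∈ fam, e ∈ m.2 ∧ m.1 ≤ (m.2.map (s.arr 6)).sum then 1 else s.arr 8 e := by
  rw [stored_cons] at hr
  simp only [fullProg, wp_seq, wp_setReg, Prog.incr, Prog.decr]
  refine WP.mono (wp_loop (fun (k : List (ℕ × List ℕ)) s' => s'.reg 4 = k.length ∧
    Stored (s.arr 5) (s'.reg 3) (famCode k) ∧ (∀ m ∈ k, m ∈ fam) ∧
    ∀ e, (¬ ∃ m ∈ k, e ∈ m.2 ∧ m.1 ≤ (m.2.map (s.arr 6)).sum) → s'.arr 8 e =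
      if ∃ m ∈ fam, e ∈ m.2 ∧ m.1 ≤ (m.2.map (s.arr 6)).sum then 1 else s.arr 8 e)
    (fun k => 60 * (famCode k).length) (b₀ := fam) ?_ ?_) ?_
  · simp only [Expr.eval, Function.update_apply]
    simp only [reduceIte, Nat.reduceEqDiff, hr.1, hr.2, true_and]
    exact ⟨fun m hm => hm, fun e he => (if_neg he).symm⟩
  · rintro (_ | ⟨⟨q, l⟩, k⟩) s' hs ⟨h1, h2, h3, h4⟩ he
    · exact absurd h1 he
    have e5 := hs.2 5 (by simp [Prog.arrs, memberProg, fillProg, Prog.incr, Prog.decr])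
    have e6 := hs.2 6 (by simp [Prog.arrs, memberProg, fillProg, Prog.incr, Prog.decr])
    simp at e5 e6
    have hcode : famCode ((q, l) :: k) = q :: l.length :: l ++ famCode k := rfl
    rw [hcode, stored_append] at h2
    obtain ⟨h2, h2'⟩ := h2
    simp only [wp_seq, wp_setReg, wp_ite]
    refine WP.mono (WP.same (wp_memberProg (e5 ▸ h2))) ?_
    rintro t1 s1 ⟨hs1, ht1, m3, m6, m5, -⟩
    have f4 := hs1.1 4 (by simp [Prog.regs, memberProg, Prog.incr, Prog.decr])
    have f5 := hs1.2 5 (by simp [Prog.arrs, memberProg, Prog.incr, Prog.decr])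
    have f8 := hs1.2 8 (by simp [Prog.arrs, memberProg, Prog.incr, Prog.decr])
    rw [e6] at m5
    have hlen : (q :: l.length :: l).length = l.length + 2 := rfl
    rw [stored_cons, stored_cons] at h2
    constructor
    · intro h5
      have h5' : s1.reg 5 ≠ 0 := h5
      refine ⟨k, ?_, ?_, ?_, fun m hm => h3 m (List.mem_cons_of_mem _ hm), fun e he => ?_⟩
      · simp only [Expr.cost, hcode, List.length_append, List.length_cons]
        omega
      · simp [Expr.eval, f4, h1]
      · simp only [Expr.eval, Function.update_apply]
        simp only [reduceIte, Nat.reduceEqDiff, m3, m6]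
        rwa [hlen, show s'.reg 3 + (l.length + 2) = s'.reg 3 + 2 + l.length by omega] at h2'
      · simp only [f8]
        refine h4 e ?_
        rintro ⟨m, hm, hem, hq⟩
        rcases List.mem_cons.1 hm with rfl | hm
        · simp only at hq
          omega
        · exact he ⟨m, hm, hem, hq⟩
    · intro h5
      have h5' : s1.reg 5 = 0 := h5
      refine WP.mono (WP.same (wp_fillProg (by norm_num) (Or.inl rfl) (l := l)
        (by rw [f5, e5, m3]; exact h2.2.2) m6)) ?_
      rintro t2 s2 ⟨hs2, ht2, g3, g8⟩
      have g4 := hs2.1 4 (by simp [Prog.regs, fillProg, Prog.incr, Prog.decr])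
      refine ⟨k, ?_, ?_, ?_, fun m hm => h3 m (List.mem_cons_of_mem _ hm), fun e he => ?_⟩
      · simp only [Expr.cost, hcode, List.length_append, List.length_cons]
        omega
      · simp [Expr.eval, g4, f4, h1]
      · simp only [Function.update_apply]
        simp only [reduceIte, Nat.reduceEqDiff, g3, m3]
        rwa [hlen, show s'.reg 3 + (l.length + 2) = s'.reg 3 + 2 + l.length by omega] at h2'
      · rw [g8, f8]
        by_cases hel : e ∈ l
        · rw [if_pos hel, if_pos ⟨(q, l), h3 _ List.mem_cons_self, hel, by simp only; omega⟩]
          rfl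
        · rw [if_neg hel]
          refine h4 e ?_
          rintro ⟨m, hm, hem, hq⟩
          rcases List.mem_cons.1 hm with rfl | hm
          · exact hel hem
          · exact he ⟨m, hm, hem, hq⟩
  · rintro t s' ⟨ht, hs, he, k, h1, h2, h3, h4⟩
    have hk : k = [] := List.eq_nil_of_length_eq_zero (h1.symm.trans he)
    subst hk
    refine ⟨?_, fun e => h4 e (by simp)⟩
    simp only [Expr.cost] at ht ⊢
    omega

/-- Clears the cells of the array 8 that belong to contracts of the worker `r3`. -/
def clearProg : Prog :=
  Prog.seq (Prog.setReg 4 (Expr.lit 0))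
  (Prog.loop (Expr.sub (Expr.reg 0) (Expr.reg 4))
    (Prog.seq (Prog.ite (Expr.dist (Expr.get 0 (Expr.reg 4)) (Expr.reg 3)) Prog.skip
      (Prog.setArr 8 (Expr.reg 4) (Expr.lit 0)))
    (Prog.incr 4 (Expr.lit 1))))

theorem wp_clearProg (s : State) :
    WP clearProg s fun t s' => t ≤ 30 * s.reg 0 + 10 ∧ ∀ e, s'.arr 8 e =
      if e < s.reg 0 ∧ s.arr 0 e = s.reg 3 then 0 else s.arr 8 e := by
  simp only [clearProg, wp_seq, wp_setReg]
  refine WP.mono (wp_loop (fun (i : ℕ) s' => i ≤ s.reg 0 ∧ s'.reg 4 = i ∧ ∀ e, s'.arr 8 e =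
      if e < i ∧ s.arr 0 e = s.reg 3 then 0 else s.arr 8 e)
    (fun i => 30 * (s.reg 0 - i)) (b₀ := 0) ?_ ?_) ?_
  · simp [Expr.eval]
  · rintro i s' hs ⟨h1, h2, h3⟩ he
    have r0 := hs.1 0 (by simp [Prog.regs, Prog.incr])
    have r3 := hs.1 3 (by simp [Prog.regs, Prog.incr])
    have e0 := hs.2 0 (by simp [Prog.arrs, Prog.incr])
    simp at r0 r3 e0
    simp only [Expr.eval, r0, h2] at he
    simp only [wp_seq, wp_setReg, wp_ite, wp_setArr, wp_skip, Prog.incr]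
    constructor
    · intro hd
      simp only [Expr.eval, Expr.dist, h2, e0, r3] at hd
      refine ⟨i + 1, ?_, by omega, by simp [Expr.eval, h2], fun e => ?_⟩
      · simp only [Expr.cost, Expr.dist]
        omega
      · rw [h3]
        by_cases hei : e = i
        · subst hei
          rw [if_neg (by omega), if_neg (by omega)]
        · simp only [show e < i + 1 ↔ e < i by omega]
    · intro hd
      simp only [Expr.eval, Expr.dist, h2, e0, r3] at hd
      refine ⟨i + 1, ?_, by omega, by simp [Expr.eval, h2], fun e => ?_⟩
      · simp only [Expr.cost, Expr.dist]
        omega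
      · simp only [Expr.eval, Function.update_self, h2]
        by_cases hei : e = i
        · subst hei
          rw [Function.update_self, if_pos (by omega)]
        · rw [Function.update_of_ne hei, h3]
          simp only [show e < i + 1 ↔ e < i by omega]
  · rintro t s' ⟨ht, hs, he, i, h1, h2, h3⟩
    have r0 := hs.1 0 (by simp [Prog.regs, Prog.incr])
    simp at r0
    simp only [Expr.eval, r0, h2] at he
    obtain rfl : i = s.reg 0 := by omega
    refine ⟨?_, h3⟩
    simp only [Expr.cost] at ht ⊢
    omega

/-- Recomputes the cells of the array 8 that belong to contracts of the worker of the contract in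
the register `x`: they are set to 1 if there is no room for the contract. -/
def refreshProg (x : ℕ) : Prog :=
  Prog.seq (Prog.setReg 3 (Expr.get 0 (Expr.reg x)))
  (Prog.seq clearProg
  (Prog.seq (Prog.setReg 3 (Expr.get 3 (Expr.reg 3)))
  fullProg))

theorem wp_refreshProg {x : ℕ} {s : State} {fam : List (ℕ × List ℕ)}
    (hr : Stored (s.arr 5) (s.arr 3 (s.arr 0 (s.reg x))) (fam.length :: famCode fam)) :
    WP (refreshProg x) s fun t s' => t ≤ 60 * (famCode fam).length + 30 * s.reg 0 + 32 ∧
      ∀ e, s'.arr 8 e = if ∃ m ∈ fam, e ∈ m.2 ∧ m.1 ≤ (m.2.map (s.arr 6)).sum then 1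
        else if e < s.reg 0 ∧ s.arr 0 e = s.arr 0 (s.reg x) then 0 else s.arr 8 e := by
  simp only [refreshProg, wp_seq, wp_setReg]
  refine WP.mono (WP.same (wp_clearProg _)) ?_
  rintro t1 s1 ⟨hs1, ht1, h1⟩
  have r3 := hs1.1 3 (by simp [Prog.regs, clearProg, Prog.incr])
  have e3 := hs1.2 3 (by simp [Prog.arrs, clearProg, Prog.incr])
  have e5 := hs1.2 5 (by simp [Prog.arrs, clearProg, Prog.incr])
  have e6 := hs1.2 6 (by simp [Prog.arrs, clearProg, Prog.incr])
  simp [Expr.eval] at r3 e3 e5 e6 h1 ht1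
  refine WP.mono (wp_fullProg (fam := fam) (by simpa [Expr.eval, r3, e3, e5] using hr)) ?_
  rintro t2 s2 ⟨ht2, h2⟩
  refine ⟨?_, fun e => ?_⟩
  · simp only [Expr.cost]
    omega
  · rw [h2]
    simp only [e6, h1]

/-- Finds the smallest member without room, among those which contain the contract `r10`, of the
laminar family of the firm of `r10`: `r11` becomes the address and `r12` the length of its list of
contracts. If there is none, `r12` becomes larger than the number of contracts. -/
def smallestProg : Prog :=
  Prog.seq (Prog.setReg 3 (Expr.get 3 (Expr.add (Expr.reg 1) (Expr.get 1 (Expr.reg 10)))))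
  (Prog.seq (Prog.setReg 4 (Expr.get 5 (Expr.reg 3)))
  (Prog.seq (Prog.incr 3 (Expr.lit 1))
  (Prog.seq (Prog.setReg 12 (Expr.add (Expr.reg 0) (Expr.lit 1)))
  (Prog.loop (Expr.reg 4)
    (Prog.seq memberProg
    (Prog.seq (Prog.ite (Expr.add (Expr.reg 5) (Expr.reg 7)) Prog.skip
      (Prog.ite (Expr.sub (Expr.reg 12) (Expr.reg 6))
        (Prog.seq (Prog.setReg 11 (Expr.reg 3)) (Prog.setReg 12 (Expr.reg 6))) Prog.skip))
    (Prog.seq (Prog.incr 3 (Expr.reg 6)) (Prog.decr 4))))))))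

theorem wp_smallestProg {s : State} {fam : List (ℕ × List ℕ)}
    (hr : Stored (s.arr 5) (s.arr 3 (s.reg 1 + s.arr 1 (s.reg 10))) (fam.length :: famCode fam))
    (hlen : ∀ m ∈ fam, m.2.length ≤ s.reg 0) :
    WP smallestProg s fun t s' => t ≤ 60 * (famCode fam).length + 30 ∧
      ((s'.reg 12 = s.reg 0 + 1 ∧
        ∀ m ∈ fam, ¬ (s.reg 10 ∈ m.2 ∧ m.1 ≤ (m.2.map (s.arr 6)).sum)) ∨
      ∃ m ∈ fam, (s.reg 10 ∈ m.2 ∧ m.1 ≤ (m.2.map (s.arr 6)).sum) ∧ s'.reg 12 = m.2.length ∧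
        Stored (s.arr 5) (s'.reg 11) m.2 ∧
        ∀ m' ∈ fam, s.reg 10 ∈ m'.2 ∧ m'.1 ≤ (m'.2.map (s.arr 6)).sum →
          m.2.length ≤ m'.2.length) := by
  rw [stored_cons] at hr
  simp only [smallestProg, wp_seq, wp_setReg, Prog.incr, Prog.decr]
  refine WP.mono (wp_loop (fun (k : List (ℕ × List ℕ)) s' => s'.reg 4 = k.length ∧
    Stored (s.arr 5) (s'.reg 3) (famCode k) ∧ (∀ m ∈ k, m ∈ fam) ∧
    (∀ m ∈ fam, m ∈ k ∨ (s.reg 10 ∈ m.2 ∧ m.1 ≤ (m.2.map (s.arr 6)).sum →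
      s'.reg 12 ≤ m.2.length)) ∧
    (s'.reg 12 = s.reg 0 + 1 ∨ ∃ m ∈ fam, (s.reg 10 ∈ m.2 ∧ m.1 ≤ (m.2.map (s.arr 6)).sum) ∧
      s'.reg 12 = m.2.length ∧ Stored (s.arr 5) (s'.reg 11) m.2))
    (fun k => 60 * (famCode k).length) (b₀ := fam) ?_ ?_) ?_
  · simp only [Expr.eval, Function.update_apply]
    simp only [reduceIte, Nat.reduceEqDiff, hr.1, hr.2, true_and, true_or, and_true]
    exact ⟨fun m hm => hm, fun m hm => Or.inl hm⟩
  · rintro (_ | ⟨⟨q, l⟩, k⟩) s' hs ⟨h1, h2, h3, h4, h5⟩ he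
    · exact absurd h1 he
    have e5 := hs.2 5 (by simp [Prog.arrs, memberProg, Prog.incr, Prog.decr])
    have e6 := hs.2 6 (by simp [Prog.arrs, memberProg, Prog.incr, Prog.decr])
    have r10 := hs.1 10 (by simp [Prog.regs, memberProg, Prog.incr, Prog.decr])
    simp at e5 e6 r10
    have hcode : famCode ((q, l) :: k) = q :: l.length :: l ++ famCode k := rfl
    rw [hcode, stored_append] at h2
    obtain ⟨h2, h2'⟩ := h2
    simp only [wp_seq, wp_setReg, wp_ite, wp_skip]
    refine WP.mono (WP.same (wp_memberProg (e5 ▸ h2))) ?_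
    rintro t1 s1 ⟨hs1, ht1, m3, m6, m5, m7⟩
    have f4 := hs1.1 4 (by simp [Prog.regs, memberProg, Prog.incr, Prog.decr])
    have f11 := hs1.1 11 (by simp [Prog.regs, memberProg, Prog.incr, Prog.decr])
    have f12 := hs1.1 12 (by simp [Prog.regs, memberProg, Prog.incr, Prog.decr])
    rw [e6] at m5
    rw [r10] at m7
    have hlen' : (q :: l.length :: l).length = l.length + 2 := rfl
    rw [hlen', show s'.reg 3 + (l.length + 2) = s'.reg 3 + 2 + l.length by omega] at h2'
    rw [stored_cons, stored_cons] at h2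
    have hk : ∀ m ∈ k, m ∈ fam := fun m hm => h3 m (List.mem_cons_of_mem _ hm)
    refine ⟨fun h57 => ?_, fun h57 => ⟨fun hlt => ?_, fun hlt => ?_⟩⟩
    · refine ⟨k, ?_, ?_, ?_, hk, fun m hm => ?_, ?_⟩
      · simp only [Expr.cost, hcode, List.length_append, List.length_cons]
        omega
      · simp [Expr.eval, f4, h1]
      · simpa [Expr.eval, m3, m6] using h2'
      · simp only [Expr.eval, Function.update_apply]
        simp only [reduceIte, Nat.reduceEqDiff, f12]
        rcases h4 m hm with h | h
        · rcases List.mem_cons.1 h with rfl | h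
          · right
            rintro ⟨h6, h7⟩
            simp only [Expr.eval] at h57 h6 h7
            have := m7.2 h6
            omega
          · exact Or.inl h
        · exact Or.inr h
      · simpa [Expr.eval, f12, f11] using h5
    · simp only [Expr.eval, f12, m6] at h57 hlt
      have htight : s.reg 10 ∈ l ∧ q ≤ (l.map (s.arr 6)).sum := ⟨m7.1 (by omega), by omega⟩
      refine ⟨k, ?_, ?_, ?_, hk, fun m hm => ?_, ?_⟩
      · simp only [Expr.cost, hcode, List.length_append, List.length_cons]
        omega
      · simp [Expr.eval, f4, h1]
      · simpa [Expr.eval, m3, m6] using h2'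
      · simp only [Expr.eval, Function.update_apply]
        simp only [reduceIte, Nat.reduceEqDiff, m6]
        rcases h4 m hm with h | h
        · rcases List.mem_cons.1 h with rfl | h
          · exact Or.inr fun _ => le_rfl
          · exact Or.inl h
        · exact Or.inr fun ht => by have := h ht; omega
      · right
        refine ⟨(q, l), h3 _ List.mem_cons_self, htight, ?_, ?_⟩
        · simp [Expr.eval, m6]
        · simpa [Expr.eval, m3] using h2.2.2
    · simp only [Expr.eval, f12, m6] at h57 hlt
      refine ⟨k, ?_, ?_, ?_, hk, fun m hm => ?_, ?_⟩
      · simp only [Expr.cost, hcode, List.length_append, List.length_cons]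
        omega
      · simp [Expr.eval, f4, h1]
      · simpa [Expr.eval, m3, m6] using h2'
      · simp only [Expr.eval, Function.update_apply]
        simp only [reduceIte, Nat.reduceEqDiff, f12]
        rcases h4 m hm with h | h
        · rcases List.mem_cons.1 h with rfl | h
          · exact Or.inr fun _ => by simp only; omega
          · exact Or.inl h
        · exact Or.inr h
      · simpa [Expr.eval, f12, f11] using h5
  · rintro t s' ⟨ht, hs, he, k, h1, h2, h3, h4, h5⟩
    have hk : k = [] := List.eq_nil_of_length_eq_zero (h1.symm.trans he)
    subst hk
    refine ⟨?_, ?_⟩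
    · simp only [Expr.cost] at ht ⊢
      omega
    · have h4' := fun m hm => (h4 m hm).resolve_left (List.not_mem_nil)
      by_cases h12 : s'.reg 12 = s.reg 0 + 1
      · left
        refine ⟨h12, fun m hm htight => ?_⟩
        have h6 := h4' m hm htight
        have h7 := hlen m hm
        omega
      · right
        obtain ⟨m, hm, htight, h6, h7⟩ := h5.resolve_left h12
        exact ⟨m, hm, htight, h6, h7, fun m' hm' ht' => h6 ▸ h4' m' hm' ht'⟩

/-- The rank which its firm assigns to the current copy of the contract in the register `x`. -/
def firmExpr (x : ℕ) : Expr :=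
  Expr.add (Expr.add (Expr.add (Expr.get 10 (Expr.reg x)) (Expr.get 10 (Expr.reg x)))
    (Expr.sub (Expr.lit 2) (Expr.get 7 (Expr.reg x))))
    (Expr.get 11 (Expr.sub (Expr.sub (Expr.lit 2) (Expr.get 7 (Expr.reg x))) (Expr.lit 1)))

/-- The value of `firmExpr` for the contract `e`. -/
def firmVal (s : State) (e : ℕ) : ℕ :=
  s.arr 10 e + s.arr 10 e + (2 - s.arr 7 e) + s.arr 11 (2 - s.arr 7 e - 1)

/-- The rank which its worker assigns to the current copy of the contract in the register `x`. -/
def workerExpr (x : ℕ) : Expr :=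
  Expr.add (Expr.add (Expr.add (Expr.get 9 (Expr.reg x)) (Expr.get 9 (Expr.reg x)))
    (Expr.get 7 (Expr.reg x)))
    (Expr.get 11 (Expr.sub (Expr.get 7 (Expr.reg x)) (Expr.lit 1)))

/-- The value of `workerExpr` for the contract `e`. -/
def workerVal (s : State) (e : ℕ) : ℕ :=
  s.arr 9 e + s.arr 9 e + s.arr 7 e + s.arr 11 (s.arr 7 e - 1)

/-- Finds the worst contract `r13` for its firm among `r10` and the contracts of the current
matching in the list of length `r12` at the address `r11`. -/
def worstProg : Prog :=
  Prog.seq (Prog.setReg 13 (Expr.reg 10))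
  (Prog.seq (Prog.setReg 14 (firmExpr 10))
  (Prog.loop (Expr.reg 12)
    (Prog.seq (Prog.setReg 5 (Expr.get 5 (Expr.reg 11)))
    (Prog.seq (Prog.ite (Expr.get 6 (Expr.reg 5))
      (Prog.seq (Prog.setReg 6 (firmExpr 5))
        (Prog.ite (Expr.sub (Expr.reg 6) (Expr.reg 14))
          (Prog.seq (Prog.setReg 13 (Expr.reg 5)) (Prog.setReg 14 (Expr.reg 6))) Prog.skip))
      Prog.skip)
    (Prog.seq (Prog.incr 11 (Expr.lit 1)) (Prog.decr 12))))))

theorem wp_worstProg {s : State} {l : List ℕ} (hl : Stored (s.arr 5) (s.reg 11) l)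
    (h12 : s.reg 12 = l.length) :
    WP worstProg s fun t s' => t ≤ 60 * l.length + 30 ∧
      (s'.reg 13 = s.reg 10 ∨ s'.reg 13 ∈ l ∧ s.arr 6 (s'.reg 13) ≠ 0) ∧
      firmVal s (s.reg 10) ≤ firmVal s (s'.reg 13) ∧
      ∀ m ∈ l, s.arr 6 m ≠ 0 → firmVal s m ≤ firmVal s (s'.reg 13) := by
  simp only [worstProg, wp_seq, wp_setReg]
  refine WP.mono (wp_loop (fun (k : List ℕ) s' => s'.reg 12 = k.length ∧
    Stored (s.arr 5) (s'.reg 11) k ∧ (∀ m ∈ k, m ∈ l) ∧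
    (s'.reg 13 = s.reg 10 ∨ s'.reg 13 ∈ l ∧ s.arr 6 (s'.reg 13) ≠ 0) ∧
    s'.reg 14 = firmVal s (s'.reg 13) ∧
    firmVal s (s.reg 10) ≤ firmVal s (s'.reg 13) ∧
    ∀ m ∈ l, m ∈ k ∨ (s.arr 6 m ≠ 0 → firmVal s m ≤ firmVal s (s'.reg 13)))
    (fun k => 60 * k.length) (b₀ := l) ?_ ?_) ?_
  · simp only [Expr.eval, Function.update_apply, firmExpr, firmVal]
    simp only [reduceIte, Nat.reduceEqDiff, h12, hl, true_and, true_or, le_refl]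
    exact ⟨fun m hm => hm, fun m hm => Or.inl hm⟩
  · rintro (_ | ⟨x, k⟩) s' hs ⟨h1, h2, h3, h4, h5, h6, h7⟩ he
    · exact absurd h1 he
    have e5 := hs.2 5 (by simp [Prog.arrs, Prog.incr, Prog.decr])
    have e6 := hs.2 6 (by simp [Prog.arrs, Prog.incr, Prog.decr])
    have e7 := hs.2 7 (by simp [Prog.arrs, Prog.incr, Prog.decr])
    have e10 := hs.2 10 (by simp [Prog.arrs, Prog.incr, Prog.decr])
    have e11 := hs.2 11 (by simp [Prog.arrs, Prog.incr, Prog.decr])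
    simp at e5 e6 e7 e10 e11
    rw [stored_cons] at h2
    have hk : ∀ m ∈ k, m ∈ l := fun m hm => h3 m (List.mem_cons_of_mem _ hm)
    simp only [wp_seq, wp_setReg, wp_ite, wp_skip, Prog.incr, Prog.decr]
    refine ⟨fun h => ⟨fun h' => ?_, fun h' => ?_⟩, fun h => ?_⟩
    · simp [Expr.eval, firmExpr, e5, e6, e7, e10, e11, h2.1] at h h'
      refine ⟨k, ?_, ?_⟩
      · simp only [Expr.cost, firmExpr, List.length_cons]
        omega
      · simp [Expr.eval, firmExpr, e5, e7, e10, e11, h2.1, h1, h2.2]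
        rw [h5] at h'
        change ¬ firmVal s x - firmVal s (s'.reg 13) = 0 at h'
        have h' : firmVal s (s'.reg 13) < firmVal s x := by omega
        refine ⟨hk, Or.inr ⟨h3 x List.mem_cons_self, h⟩, rfl, by omega, fun m hm => ?_⟩
        rcases h7 m hm with h8 | h8
        · rcases List.mem_cons.1 h8 with rfl | h8
          · exact Or.inr fun _ => le_rfl
          · exact Or.inl h8
        · exact Or.inr fun h9 => (h8 h9).trans h'.le
    · simp [Expr.eval, firmExpr, e5, e6, e7, e10, e11, h2.1] at h h'
      refine ⟨k, ?_, ?_⟩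
      · simp only [Expr.cost, firmExpr, List.length_cons]
        omega
      · simp [Expr.eval, h1, h2.2]
        rw [h5] at h'
        change firmVal s x - firmVal s (s'.reg 13) = 0 at h'
        have h' : firmVal s x ≤ firmVal s (s'.reg 13) := by omega
        refine ⟨hk, h4, h5, h6, fun m hm => ?_⟩
        rcases h7 m hm with h8 | h8
        · rcases List.mem_cons.1 h8 with rfl | h8
          · exact Or.inr fun _ => h'
          · exact Or.inl h8
        · exact Or.inr h8
    · simp [Expr.eval, e5, e6, h2.1] at h
      refine ⟨k, ?_, ?_⟩
      · simp only [Expr.cost, List.length_cons]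
        omega
      · simp [Expr.eval, h1, h2.2]
        refine ⟨hk, h4, h5, h6, fun m hm => ?_⟩
        rcases h7 m hm with h8 | h8
        · rcases List.mem_cons.1 h8 with rfl | h8
          · exact Or.inr fun h9 => absurd h h9
          · exact Or.inl h8
        · exact Or.inr h8
  · rintro t s' ⟨ht, hs, he, k, h1, h2, h3, h4, h5, h6, h7⟩
    have hk : k = [] := List.eq_nil_of_length_eq_zero (h1.symm.trans he)
    subst hk
    refine ⟨?_, h4, h6, fun m hm => (h7 m hm).resolve_left List.not_mem_nil⟩
    simp only [Expr.cost, firmExpr] at ht ⊢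
    omega

/-- The contract `e` can be proposed according to the arrays of the state. -/
def Eligible (s : State) (e : ℕ) : Prop := s.arr 6 e + s.arr 8 e + (s.arr 7 e - 2) = 0

/-- Finds a contract `r10` of least rank among those that can be proposed; `r15` becomes zero if
there is none. -/
def findProg : Prog :=
  Prog.seq (Prog.setReg 14 (Expr.add (Expr.add (Expr.add (Expr.reg 0) (Expr.reg 0))
    (Expr.add (Expr.reg 0) (Expr.reg 0))) (Expr.lit 3)))
  (Prog.seq (Prog.setReg 15 (Expr.lit 0))
  (Prog.seq (Prog.setReg 3 (Expr.lit 0))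
  (Prog.loop (Expr.sub (Expr.reg 0) (Expr.reg 3))
    (Prog.seq (Prog.ite (Expr.add (Expr.add (Expr.get 6 (Expr.reg 3)) (Expr.get 8 (Expr.reg 3)))
        (Expr.sub (Expr.get 7 (Expr.reg 3)) (Expr.lit 2)))
      Prog.skip
      (Prog.seq (Prog.setReg 4 (workerExpr 3))
        (Prog.ite (Expr.sub (Expr.reg 14) (Expr.reg 4))
          (Prog.seq (Prog.setReg 10 (Expr.reg 3))
          (Prog.seq (Prog.setReg 14 (Expr.reg 4))
          (Prog.setReg 15 (Expr.lit 1))))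
          Prog.skip)))
    (Prog.incr 3 (Expr.lit 1))))))

theorem wp_findProg {s : State}
    (hb : ∀ e < s.reg 0, Eligible s e → workerVal s e < 4 * s.reg 0 + 3) :
    WP findProg s fun t s' => t ≤ 70 * s.reg 0 + 30 ∧
      ((s'.reg 15 = 0 ∧ ∀ e < s.reg 0, ¬ Eligible s e) ∨
      (s'.reg 15 = 1 ∧ s'.reg 10 < s.reg 0 ∧ Eligible s (s'.reg 10) ∧
        ∀ e < s.reg 0, Eligible s e → workerVal s (s'.reg 10) ≤ workerVal s e)) := by
  simp only [findProg, wp_seq, wp_setReg]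
  refine WP.mono (wp_loop (fun (i : ℕ) s' => i ≤ s.reg 0 ∧ s'.reg 3 = i ∧
    (∀ e < i, Eligible s e → s'.reg 14 ≤ workerVal s e) ∧
    ((s'.reg 15 = 0 ∧ s'.reg 14 = 4 * s.reg 0 + 3) ∨
      (s'.reg 15 = 1 ∧ s'.reg 10 < s.reg 0 ∧ Eligible s (s'.reg 10) ∧
        s'.reg 14 = workerVal s (s'.reg 10))))
    (fun i => 70 * (s.reg 0 - i)) (b₀ := 0) ?_ ?_) ?_
  · simp [Expr.eval]
    omega
  · rintro i s' hs ⟨h1, h2, h3, h4⟩ he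
    have r0 := hs.1 0 (by simp [Prog.regs, Prog.incr])
    have e6 := hs.2 6 (by simp [Prog.arrs, Prog.incr])
    have e7 := hs.2 7 (by simp [Prog.arrs, Prog.incr])
    have e8 := hs.2 8 (by simp [Prog.arrs, Prog.incr])
    have e9 := hs.2 9 (by simp [Prog.arrs, Prog.incr])
    have e11 := hs.2 11 (by simp [Prog.arrs, Prog.incr])
    simp at r0 e6 e7 e8 e9 e11
    simp only [Expr.eval, r0, h2] at he
    simp only [wp_seq, wp_setReg, wp_ite, wp_skip, Prog.incr]
    have hlast : ∀ c, (∀ e < i, Eligible s e → c ≤ workerVal s e) →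
        (Eligible s i → c ≤ workerVal s i) → ∀ e ≤ i, Eligible s e → c ≤ workerVal s e := by
      intro c h5 h6 e he hel
      rcases Nat.lt_or_eq_of_le he with h | rfl
      exacts [h5 e h hel, h6 hel]
    refine ⟨fun h => ?_, fun h => ⟨fun h' => ?_, fun h' => ?_⟩⟩
    · simp only [Expr.eval, e6, e7, e8, h2] at h
      refine ⟨i + 1, ?_, by omega, by simp [Expr.eval, h2], ?_, ?_⟩
      · simp only [Expr.cost]
        omega
      · simp [Expr.eval]
        exact hlast _ h3 fun h' => absurd h' h
      · simpa [Expr.eval] using h4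
    · simp only [Expr.eval, e6, e7, e8, h2] at h
      simp [Expr.eval, workerExpr, e7, e9, e11, h2] at h'
      change ¬ s'.reg 14 - workerVal s i = 0 at h'
      have h' : workerVal s i < s'.reg 14 := by omega
      refine ⟨i + 1, ?_, by omega, by simp [Expr.eval, h2], ?_, ?_⟩
      · simp only [Expr.cost, workerExpr]
        omega
      · simp [Expr.eval, workerExpr, e7, e9, e11, h2]
        change ∀ e ≤ i, Eligible s e → workerVal s i ≤ workerVal s e
        exact hlast _ (fun e he hel => h'.le.trans (h3 e he hel)) fun _ => le_rfl
      · right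
        simp [Expr.eval, workerExpr, e7, e9, e11, h2]
        exact ⟨by omega, h, rfl⟩
    · simp only [Expr.eval, e6, e7, e8, h2] at h
      simp [Expr.eval, workerExpr, e7, e9, e11, h2] at h'
      change s'.reg 14 - workerVal s i = 0 at h'
      have h' : s'.reg 14 ≤ workerVal s i := by omega
      refine ⟨i + 1, ?_, by omega, by simp [Expr.eval, h2], ?_, ?_⟩
      · simp only [Expr.cost, workerExpr]
        omega
      · simp [Expr.eval]
        exact hlast _ h3 fun _ => h'
      · simpa [Expr.eval] using h4
  · rintro t s' ⟨ht, hs, he, i, h1, h2, h3, h4⟩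
    have r0 := hs.1 0 (by simp [Prog.regs, Prog.incr])
    simp at r0
    simp only [Expr.eval, r0, h2] at he
    obtain rfl : i = s.reg 0 := by omega
    refine ⟨?_, ?_⟩
    · simp only [Expr.cost] at ht ⊢
      omega
    · rcases h4 with ⟨h4, h5⟩ | ⟨h4, h5, h6, h7⟩
      · left
        refine ⟨h4, fun e he hel => ?_⟩
        have h8 := h3 e he hel
        have h9 := hb e he hel
        omega
      · right
        exact ⟨h4, h5, h6, fun e he hel => h7 ▸ h3 e he hel⟩

end RAM

/-! ## Instances in the memory of the machine -/

namespace SMTILC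

open RAM

variable {nW nF n : ℕ}

/-- The part of the input format that does not depend on working memory. -/
structure Layout (I : SMTILC (Fin nW) (Fin nF) (Fin n)) (s : RAM.State) : Prop where
  num_contracts : s.reg 0 = n
  num_workers : s.reg 1 = nW
  worker : ∀ e : Fin n, s.arr 0 e = I.worker e
  firm : ∀ e : Fin n, s.arr 1 e = I.firm e
  pref : ∀ a, ∃ r, I.IsPrefRecord a r ∧ Stored (s.arr 4) (s.arr 2 (agentCode a)) r
  lam : ∀ a, ∃ r, I.IsLamRecord a r ∧ Stored (s.arr 5) (s.arr 3 (agentCode a)) r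

theorem IsInput.layout {I : SMTILC (Fin nW) (Fin nF) (Fin n)} {s : RAM.State} (h : I.IsInput s) :
    I.Layout s :=
  ⟨h.num_contracts, h.num_workers, h.worker, h.firm, h.pref, h.lam⟩

theorem Layout.congr {I : SMTILC (Fin nW) (Fin nF) (Fin n)} {s s' : RAM.State} (h : I.Layout s)
    (hr : ∀ x < 2, s'.reg x = s.reg x) (ha : ∀ b < 6, s'.arr b = s.arr b) : I.Layout s' := by
  obtain ⟨h1, h2, h3, h4, h5, h6⟩ := h
  constructor
  · rw [hr 0 (by norm_num), h1]
  · rw [hr 1 (by norm_num), h2]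
  · rwa [ha 0 (by norm_num)]
  · rwa [ha 1 (by norm_num)]
  · rwa [ha 4 (by norm_num), ha 2 (by norm_num)]
  · rwa [ha 5 (by norm_num), ha 3 (by norm_num)]

theorem card_filter_mem_le (I : SMTILC (Fin nW) (Fin nF) (Fin n)) (a : Fin nW ⊕ Fin nF)
    (e : Fin n) : ((I.lam a).filter fun L => e ∈ L).card ≤ I.nestingLevel := by
  classical
  unfold nestingLevel
  refine Finset.le_sup_of_le (Finset.mem_univ a) (Finset.le_sup_of_le ?_ le_rfl)
  rw [Finset.mem_filter, Finset.mem_powerset]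
  refine ⟨Finset.filter_subset _ _, fun L hL L' hL' _ => ?_⟩
  simp only [Finset.coe_filter, Set.mem_ofPred_eq] at hL hL'
  rcases I.laminar a L hL.1 L' hL'.1 with h | h | h
  · exact Or.inl h
  · exact Or.inr h
  · exact absurd hL'.2 (Finset.disjoint_left.1 h hL.2)

theorem sum_card_lam_le (I : SMTILC (Fin nW) (Fin nF) (Fin n)) (a : Fin nW ⊕ Fin nF) :
    ∑ L ∈ I.lam a, (L.card + 2) ≤ 5 * (max I.nestingLevel 1 * max n 1) := by
  have h1 : ∑ L ∈ I.lam a, L.card ≤ I.nestingLevel * n := by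
    calc ∑ L ∈ I.lam a, L.card = ∑ L ∈ I.lam a, ∑ e : Fin n, if e ∈ L then 1 else 0 := by simp
      _ = ∑ e : Fin n, ((I.lam a).filter fun L => e ∈ L).card := by
        rw [Finset.sum_comm]
        simp
      _ ≤ ∑ _e : Fin n, I.nestingLevel := Finset.sum_le_sum fun e _ => I.card_filter_mem_le a e
      _ = I.nestingLevel * n := by simp [mul_comm]
  have h2 : (I.lam a).card ≤ ∑ L ∈ I.lam a, L.card + 1 := by
    have h3 : ((I.lam a).erase ∅).card ≤ ∑ L ∈ (I.lam a).erase ∅, L.card := by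
      rw [Finset.card_eq_sum_ones]
      refine Finset.sum_le_sum fun L hL => Finset.card_pos.2 ?_
      exact Finset.nonempty_iff_ne_empty.2 (Finset.mem_erase.1 hL).1
    have h4 : ∑ L ∈ (I.lam a).erase ∅, L.card ≤ ∑ L ∈ I.lam a, L.card :=
      Finset.sum_le_sum_of_subset (Finset.erase_subset _ _)
    have h5 := Finset.pred_card_le_card_erase (s := I.lam a) (a := ∅)
    omega
  have h3 : I.nestingLevel * n ≤ max I.nestingLevel 1 * max n 1 :=
    Nat.mul_le_mul (le_max_left _ _) (le_max_left _ _)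
  have h4 : 1 ≤ max I.nestingLevel 1 * max n 1 :=
    Nat.mul_pos (Nat.le_max_right _ _) (Nat.le_max_right _ _)
  rw [Finset.sum_add_distrib, Finset.sum_const, smul_eq_mul]
  omega

/-- The pair `m` consists of the quota and a listing of the member `L` of the family of `a`. -/
def Describes (I : SMTILC (Fin nW) (Fin nF) (Fin n)) (a : Fin nW ⊕ Fin nF) (m : ℕ × List ℕ)
    (L : Finset (Fin n)) : Prop :=
  m.1 = I.quota a L ∧ ∃ l : List (Fin n), IsListing l L ∧ m.2 = l.map Fin.val

theorem IsListing.length_eq {α : Type*} {l : List α} {T : Finset α} (h : IsListing l T) :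
    l.length = T.card := by
  classical
  rw [← List.toFinset_card_of_nodup h.1]
  congr 1
  ext x
  simp [h.2 x]

theorem Describes.length_eq {I : SMTILC (Fin nW) (Fin nF) (Fin n)} {a : Fin nW ⊕ Fin nF}
    {m : ℕ × List ℕ} {L : Finset (Fin n)} (h : I.Describes a m L) : m.2.length = L.card := by
  obtain ⟨-, l, hl, h⟩ := h
  rw [h, List.length_map, hl.length_eq]

theorem Describes.mem_iff {I : SMTILC (Fin nW) (Fin nF) (Fin n)} {a : Fin nW ⊕ Fin nF}
    {m : ℕ × List ℕ} {L : Finset (Fin n)} (h : I.Describes a m L) {x : ℕ} :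
    x ∈ m.2 ↔ ∃ e ∈ L, (e : ℕ) = x := by
  obtain ⟨-, l, hl, h⟩ := h
  simp [h, hl.2]

theorem Describes.val_mem_iff {I : SMTILC (Fin nW) (Fin nF) (Fin n)} {a : Fin nW ⊕ Fin nF}
    {m : ℕ × List ℕ} {L : Finset (Fin n)} (h : I.Describes a m L) {e : Fin n} :
    (e : ℕ) ∈ m.2 ↔ e ∈ L := by
  simp [h.mem_iff, Fin.val_inj]

theorem Describes.sum_eq {I : SMTILC (Fin nW) (Fin nF) (Fin n)} {a : Fin nW ⊕ Fin nF}
    {m : ℕ × List ℕ} {L M : Finset (Fin n)} (h : I.Describes a m L) {A : ℕ → ℕ}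
    (hA : ∀ e : Fin n, A e = if e ∈ M then 1 else 0) : (m.2.map A).sum = (M ∩ L).card := by
  obtain ⟨-, l, hl, h⟩ := h
  have hL : l.toFinset = L := by
    ext x
    simp [hl.2 x]
  rw [h, List.map_map, ← List.sum_toFinset _ hl.1, hL, Finset.inter_comm,
    ← Finset.filter_mem_eq_inter, Finset.card_filter]
  exact Finset.sum_congr rfl fun e _ => hA e

theorem Layout.exists_family {I : SMTILC (Fin nW) (Fin nF) (Fin n)} {s : RAM.State}
    (h : I.Layout s) (a : Fin nW ⊕ Fin nF) : ∃ fam : List (ℕ × List ℕ),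
      Stored (s.arr 5) (s.arr 3 (agentCode a)) (fam.length :: famCode fam) ∧
      (famCode fam).length ≤ 5 * (max I.nestingLevel 1 * max n 1) ∧
      (∀ m ∈ fam, ∃ L ∈ I.lam a, I.Describes a m L) ∧
      ∀ L ∈ I.lam a, ∃ m ∈ fam, I.Describes a m L := by
  obtain ⟨_, ⟨F, members, hF, hm, rfl⟩, hst⟩ := h.lam a
  have key : ∀ (F : List (Finset (Fin n))) (members : List (List (Fin n))),
      List.Forall₂ IsListing members F → ∃ fam : List (ℕ × List ℕ), fam.length = F.length ∧
        (((F.map (I.quota a)).zip members).flatMap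
          fun m => m.1 :: m.2.length :: m.2.map Fin.val) = famCode fam ∧
        (famCode fam).length = (F.map fun L => L.card + 2).sum ∧
        (∀ m ∈ fam, ∃ L ∈ F, I.Describes a m L) ∧ ∀ L ∈ F, ∃ m ∈ fam, I.Describes a m L := by
    intro F members hm
    induction hm with
    | nil => exact ⟨[], by simp [famCode]⟩
    | @cons l L members F hl _ ih =>
      obtain ⟨fam, h1, h2, h3, h4, h5⟩ := ih
      have hd : I.Describes a (I.quota a L, l.map Fin.val) L := ⟨rfl, l, hl, rfl⟩
      refine ⟨(I.quota a L, l.map Fin.val) :: fam, by simp [h1], ?_, ?_, ?_, ?_⟩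
      · rw [List.map_cons, List.zip_cons_cons, List.flatMap_cons, h2]
        simp [famCode]
      · rw [List.map_cons, List.sum_cons, ← h3]
        simp [famCode, hl.length_eq]
        omega
      · intro m hm
        rcases List.mem_cons.1 hm with rfl | hm
        · exact ⟨L, List.mem_cons_self, hd⟩
        · obtain ⟨L', hL', h⟩ := h4 m hm
          exact ⟨L', List.mem_cons_of_mem _ hL', h⟩
      · intro L' hL'
        rcases List.mem_cons.1 hL' with rfl | hL'
        · exact ⟨_, List.mem_cons_self, hd⟩
        · obtain ⟨m, hm, h⟩ := h5 L' hL'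
          exact ⟨m, List.mem_cons_of_mem _ hm, h⟩
  obtain ⟨fam, h1, h2, h3, h4, h5⟩ := key F members hm
  refine ⟨fam, ?_, ?_, ?_, ?_⟩
  · rwa [h1, ← h2]
  · refine h3.trans_le (le_trans (le_of_eq ?_) (I.sum_card_lam_le a))
    rw [← List.sum_toFinset _ hF.1]
    congr 1
    ext L
    simp [hF.2 L]
  · intro m hm
    obtain ⟨L, hL, h⟩ := h4 m hm
    exact ⟨L, (hF.2 L).1 hL, h⟩
  · intro L hL
    exact h5 L ((hF.2 L).2 hL)

theorem noRoom_iff_of_family {I : SMTILC (Fin nW) (Fin nF) (Fin n)} {a : Fin nW ⊕ Fin nF}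
    {fam : List (ℕ × List ℕ)} (h1 : ∀ m ∈ fam, ∃ L ∈ I.lam a, I.Describes a m L)
    (h2 : ∀ L ∈ I.lam a, ∃ m ∈ fam, I.Describes a m L) {M : Finset (Fin n)} {A : ℕ → ℕ}
    (hA : ∀ e : Fin n, A e = if e ∈ M then 1 else 0) (e : Fin n) :
    (∃ m ∈ fam, (e : ℕ) ∈ m.2 ∧ m.1 ≤ (m.2.map A).sum) ↔ I.NoRoom a M e := by
  constructor
  · rintro ⟨m, hm, he, hq⟩
    obtain ⟨L, hL, hd⟩ := h1 m hm
    exact ⟨L, hL, hd.val_mem_iff.1 he, by rwa [← hd.sum_eq hA, ← hd.1]⟩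
  · rintro ⟨L, hL, he, hq⟩
    obtain ⟨m, hm, hd⟩ := h2 L hL
    exact ⟨m, hm, hd.val_mem_iff.2 he, by rwa [hd.sum_eq hA, hd.1]⟩

theorem Layout.exists_ties {I : SMTILC (Fin nW) (Fin nF) (Fin n)} {s : RAM.State}
    (h : I.Layout s) (a : Fin nW ⊕ Fin nF) : ∃ ties : List (List ℕ),
      Stored (s.arr 4) (s.arr 2 (agentCode a))
        (ties.length :: ties.flatMap fun l => l.length :: l) ∧
      (ties.length :: ties.flatMap fun l => l.length :: l).length ≤ 3 * max n 1 ∧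
      (∀ i (hi : i < ties.length), ∀ x ∈ ties[i],
        ∃ e : Fin n, (e : ℕ) = x ∧ e ∈ I.contracts a ∧ I.tieIndex a e = i) ∧
      ∀ e ∈ I.contracts a, (e : ℕ) ∈ ties.flatten := by
  obtain ⟨_, ⟨ties, ht, rfl⟩, hst⟩ := h.pref a
  have hlen : (ties.map List.length).sum = ((I.prefList a).map Finset.card).sum := by
    clear hst
    generalize I.prefList a = T at ht
    induction ht with
    | nil => rfl
    | cons hl _ ih => rw [List.map_cons, List.map_cons, List.sum_cons, List.sum_cons, ih,
        hl.length_eq]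
  have hget := List.forall₂_iff_get.1 ht
  refine ⟨ties.map (List.map Fin.val), ?_, ?_, ?_, ?_⟩
  · simpa [List.flatMap_map] using hst
  · have h1 : (ties.map (List.map Fin.val)).length ≤ n := by
      rw [List.length_map, ht.length_eq]
      simpa using I.length_prefList_le a
    have h2 : (ties.map List.length).sum ≤ n := by
      rw [hlen, I.sum_card_prefList]
      simpa using Finset.card_le_univ (I.contracts a)
    have h3 : ((ties.map (List.map Fin.val)).flatMap fun l => l.length :: l).length =
        (ties.map List.length).sum + ties.length := by
      rw [List.flatMap_map, List.length_flatMap]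
      simp only [List.length_cons, List.length_map]
      clear hlen hget h1 h2 ht hst
      induction ties with
      | nil => rfl
      | cons l ties ih => simp [ih]; omega
    rw [List.length_map] at h1
    rw [List.length_cons, h3]
    have := le_max_left n 1
    have := le_max_right n 1
    omega
  · intro i hi x hx
    rw [List.length_map] at hi
    rw [List.getElem_map, List.mem_map] at hx
    obtain ⟨e, he, rfl⟩ := hx
    have hi' : i < (I.prefList a).length := hget.1 ▸ hi
    have he' : e ∈ (I.prefList a)[i] := ((hget.2 i hi hi').2 e).1 he
    exact ⟨e, rfl, mem_contracts.2 ((I.pref_cover a e).1 ⟨_, List.getElem_mem hi', he'⟩),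
      tieIndex_eq hi' he'⟩
  · intro e he
    have hi' := tieIndex_lt_length he
    have hi : I.tieIndex a e < ties.length := hget.1.symm ▸ hi'
    rw [List.mem_flatten]
    refine ⟨ties[I.tieIndex a e].map Fin.val, List.mem_map_of_mem (List.getElem_mem hi), ?_⟩
    exact List.mem_map_of_mem (((hget.2 _ hi hi').2 e).2 (mem_getElem_tieIndex he))

/-- The arrays describe the matching `M` and the numbers `st` of rejected copies. -/
structure Represents (I : SMTILC (Fin nW) (Fin nF) (Fin n)) (M : Finset (Fin n)) (st : Fin n → ℕ)
    (s : RAM.State) : Prop where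
  layout : I.Layout s
  matching : ∀ e : Fin n, s.arr 6 e = if e ∈ M then 1 else 0
  label : ∀ e : Fin n, s.arr 7 e = st e
  room : ∀ e : Fin n, s.arr 8 e = 0 ↔ ¬ I.NoRoom (Sum.inl (I.worker e)) M e
  workerTie : ∀ e : Fin n, s.arr 9 e = I.tieIndex (Sum.inl (I.worker e)) e
  firmTie : ∀ e : Fin n, s.arr 10 e = I.tieIndex (Sum.inr (I.firm e)) e
  shift_zero : s.arr 11 0 = 0
  shift_one : s.arr 11 1 = n + n

theorem Represents.firmVal_eq {I : SMTILC (Fin nW) (Fin nF) (Fin n)} {M : Finset (Fin n)}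
    {st : Fin n → ℕ} {s : RAM.State} (h : I.Represents M st s) (e : Fin n) :
    firmVal s e = I.firmLevel e (st e) := by
  simp only [firmVal, firmLevel, level, h.firmTie, h.label, Fintype.card_fin]
  by_cases h2 : 2 - st e = 2
  · rw [if_pos h2, show 2 - st e - 1 = 1 by omega, h.shift_one]
  · rw [if_neg h2, show 2 - st e - 1 = 0 by omega, h.shift_zero]

theorem Represents.workerVal_eq {I : SMTILC (Fin nW) (Fin nF) (Fin n)} {M : Finset (Fin n)}
    {st : Fin n → ℕ} {s : RAM.State} (h : I.Represents M st s) {e : Fin n} (he : st e < 3) :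
    workerVal s e = I.workerLevel e (st e) := by
  simp only [workerVal, workerLevel, level, h.workerTie, h.label, Fintype.card_fin]
  by_cases h2 : st e = 2
  · rw [if_pos h2, show st e - 1 = 1 by omega, h.shift_one]
  · rw [if_neg h2, show st e - 1 = 0 by omega, h.shift_zero]

theorem Represents.eligible_iff {I : SMTILC (Fin nW) (Fin nF) (Fin n)} {M : Finset (Fin n)}
    {st : Fin n → ℕ} {s : RAM.State} (h : I.Represents M st s) (e : Fin n) :
    Eligible s e ↔ I.Proposable M st e := by
  have h1 := h.room e
  have h2 := h.matching e
  have h3 := h.label e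
  unfold Eligible Proposable
  rw [← h1, h2, h3]
  split_ifs with hM <;> simp [hM]
  omega

/-- A bound for the sizes of the records of an agent, up to a constant factor. -/
noncomputable def size (I : SMTILC (Fin nW) (Fin nF) (Fin n)) : ℕ :=
  max I.nestingLevel 1 * max n 1

theorem max_le_size (I : SMTILC (Fin nW) (Fin nF) (Fin n)) : max n 1 ≤ I.size :=
  Nat.le_mul_of_pos_left _ (Nat.le_max_right _ _)

theorem noRoom_congr {I : SMTILC (Fin nW) (Fin nF) (Fin n)} {M M' : Finset (Fin n)} {e : Fin n}
    (h : ∀ x, I.worker x = I.worker e → (x ∈ M' ↔ x ∈ M)) :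
    I.NoRoom (Sum.inl (I.worker e)) M' e ↔ I.NoRoom (Sum.inl (I.worker e)) M e := by
  refine exists_congr fun L => and_congr_right fun hL => and_congr_right fun _ => ?_
  have : M' ∩ L = M ∩ L := by
    ext x
    rw [Finset.mem_inter, Finset.mem_inter]
    exact and_congr_left fun hx => h x (I.owns_worker.eq_of_mem hL hx)
  rw [this]

theorem wp_refresh {I : SMTILC (Fin nW) (Fin nF) (Fin n)} {M : Finset (Fin n)} {s : RAM.State}
    {x : ℕ} {f : Fin n} {P : Fin n → Prop} (hlay : I.Layout s)
    (hM : ∀ e : Fin n, s.arr 6 e = if e ∈ M then 1 else 0) (hx : s.reg x = f)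
    (hroom : ∀ e : Fin n, P e → (s.arr 8 e = 0 ↔ ¬ I.NoRoom (Sum.inl (I.worker e)) M e)) :
    WP (refreshProg x) s fun t s' => t ≤ 362 * I.size ∧
      ∀ e : Fin n, (P e ∨ I.worker e = I.worker f) →
        (s'.arr 8 e = 0 ↔ ¬ I.NoRoom (Sum.inl (I.worker e)) M e) := by
  obtain ⟨fam, h1, h2, h3, h4⟩ := hlay.exists_family (Sum.inl (I.worker f))
  have hiff := fun e => noRoom_iff_of_family h3 h4 hM e
  refine WP.mono (wp_refreshProg (fam := fam) ?_) ?_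
  · rwa [hx, hlay.worker]
  · rintro t s' ⟨ht, h8⟩
    constructor
    · have h5 := I.max_le_size
      have h6 := le_max_left n 1
      have h7 := le_max_right n 1
      rw [hlay.num_contracts] at ht
      change _ ≤ 5 * I.size at h2
      omega
    · intro e he
      rw [h8, hx, hlay.worker, hlay.worker, hlay.num_contracts]
      simp only [Fin.val_inj]
      by_cases hw : I.worker e = I.worker f
      · rw [hw, ← hiff e]
        split_ifs with h h'
        · exact iff_of_false not_false (not_not.2 h)
        · exact iff_of_true rfl h
        · exact absurd ⟨e.2, rfl⟩ h'
      · rw [if_neg, if_neg (fun h => hw h.2)]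
        · exact hroom e (he.resolve_right hw)
        · rintro ⟨m, hm, hem, -⟩
          obtain ⟨L, hL, hd⟩ := h3 m hm
          exact hw (I.owns_worker.eq_of_mem hL (hd.val_mem_iff.1 hem))

/-- Lets the worker of the contract `r10` propose it. -/
def proposeProg : Prog :=
  Prog.seq smallestProg
  (Prog.seq (Prog.ite (Expr.sub (Expr.add (Expr.reg 0) (Expr.lit 1)) (Expr.reg 12))
    (Prog.seq worstProg
    (Prog.seq (Prog.setArr 6 (Expr.reg 10) (Expr.lit 1))
    (Prog.seq (Prog.setArr 6 (Expr.reg 13) (Expr.lit 0))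
    (Prog.setArr 7 (Expr.reg 13) (Expr.add (Expr.get 7 (Expr.reg 13)) (Expr.lit 1))))))
    (Prog.seq (Prog.setArr 6 (Expr.reg 10) (Expr.lit 1))
    (Prog.setReg 13 (Expr.reg 10))))
  (Prog.seq (refreshProg 10) (refreshProg 13)))

theorem wp_refresh_both {I : SMTILC (Fin nW) (Fin nF) (Fin n)} {M M' : Finset (Fin n)}
    {st st' : Fin n → ℕ} {s s₁ : RAM.State} {f r : Fin n} (h : I.Represents M st s)
    (hreg : ∀ x < 2, s₁.reg x = s.reg x) (h10 : s₁.reg 10 = f) (h13 : s₁.reg 13 = r)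
    (harr : ∀ b, b ≠ 6 → b ≠ 7 → s₁.arr b = s.arr b)
    (h6 : ∀ e : Fin n, s₁.arr 6 e = if e ∈ M' then 1 else 0)
    (h7 : ∀ e : Fin n, s₁.arr 7 e = st' e)
    (hMM' : ∀ x, x ≠ f → x ≠ r → (x ∈ M' ↔ x ∈ M)) :
    WP (Prog.seq (refreshProg 10) (refreshProg 13)) s₁ fun t s' => t ≤ 724 * I.size ∧
      I.Represents M' st' s' := by
  have hlay : I.Layout s₁ := h.layout.congr hreg fun b hb => harr b (by omega) (by omega)
  rw [wp_seq]
  refine WP.mono (WP.same (wp_refresh (M := M') (f := f)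
    (P := fun e => I.worker e ≠ I.worker f ∧ I.worker e ≠ I.worker r) hlay h6 h10 ?_)) ?_
  · rintro e ⟨hf, hr⟩
    rw [harr 8 (by norm_num) (by norm_num), h.room, noRoom_congr]
    intro x hx
    exact (hMM' x (fun h => hf (by rw [← h, hx])) fun h => hr (by rw [← h, hx])).symm
  rintro t₂ s₂ ⟨hs₂, ht₂, h8⟩
  have hr2 : ∀ x, x < 2 ∨ 9 < x → s₂.reg x = s₁.reg x := by
    intro x hx
    refine hs₂.1 x ?_
    simp [Prog.regs, refreshProg, clearProg, fullProg, memberProg, fillProg, Prog.incr, Prog.decr]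
    omega
  have ha2 : ∀ b, b ≠ 8 → s₂.arr b = s₁.arr b := by
    intro x hx
    refine hs₂.2 x ?_
    simp [Prog.arrs, refreshProg, clearProg, fullProg, memberProg, fillProg, Prog.incr, Prog.decr]
    omega
  refine WP.mono (WP.same (wp_refresh (M := M') (f := r)
    (P := fun e => I.worker e ≠ I.worker r) (hlay.congr (fun x hx => hr2 x (by omega))
      fun b hb => ha2 b (by omega)) ?_ ?_ ?_)) ?_
  · intro e
    rw [ha2 6 (by norm_num), h6]
  · rw [hr2 13 (by norm_num), h13]
  · intro e he
    refine h8 e ?_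
    tauto
  rintro t₃ s₃ ⟨hs₃, ht₃, h8'⟩
  have hr3 : ∀ x, x < 2 ∨ 9 < x → s₃.reg x = s.reg x ∨ 9 < x := by
    intro x hx
    rcases hx with hx | hx
    · left
      rw [← hreg x hx, ← hr2 x (Or.inl hx)]
      refine hs₃.1 x ?_
      simp [Prog.regs, refreshProg, clearProg, fullProg, memberProg, fillProg, Prog.incr, Prog.decr]
      omega
    · exact Or.inr hx
  have ha3 : ∀ b, b ≠ 8 → s₃.arr b = s₁.arr b := by
    intro x hx
    rw [← ha2 x hx]
    refine hs₃.2 x ?_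
    simp [Prog.arrs, refreshProg, clearProg, fullProg, memberProg, fillProg, Prog.incr, Prog.decr]
    omega
  refine ⟨by omega, ?_, ?_, ?_, fun e => h8' e ?_, ?_, ?_, ?_, ?_⟩
  · refine h.layout.congr (fun x hx => ?_) fun b hb => ?_
    · rcases hr3 x (Or.inl hx) with h | h
      · exact h
      · omega
    · rw [ha3 b (by omega), harr b (by omega) (by omega)]
  · intro e
    rw [ha3 6 (by norm_num), h6]
  · intro e
    rw [ha3 7 (by norm_num), h7]
  · tauto
  · rw [ha3 9 (by norm_num), harr 9 (by norm_num) (by norm_num)]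
    exact h.workerTie
  · rw [ha3 10 (by norm_num), harr 10 (by norm_num) (by norm_num)]
    exact h.firmTie
  · rw [ha3 11 (by norm_num), harr 11 (by norm_num) (by norm_num)]
    exact h.shift_zero
  · rw [ha3 11 (by norm_num), harr 11 (by norm_num) (by norm_num)]
    exact h.shift_one

theorem wp_proposeProg {I : SMTILC (Fin nW) (Fin nF) (Fin n)} {M : Finset (Fin n)}
    {st : Fin n → ℕ} {s : RAM.State} {f : Fin n} (h : I.Represents M st s)
    (hI : I.Invariant M st) (h10 : s.reg 10 = f) (hf : I.BestProposable M st f) :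
    WP proposeProg s fun t s' => t ≤ 1300 * I.size ∧ ∃ M' st', I.Represents M' st' s' ∧
      I.Invariant M' st' ∧ progress M st < progress M' st' := by
  have hn := le_max_left n 1
  have hN := le_max_right n 1
  have hK := I.max_le_size
  obtain ⟨fam, k1, k2, k3, k4⟩ := h.layout.exists_family (Sum.inr (I.firm f))
  change _ ≤ 5 * I.size at k2
  have hfirm : s.reg 1 + s.arr 1 (s.reg 10) =
      agentCode (Sum.inr (I.firm f) : Fin nW ⊕ Fin nF) := by
    rw [h10, h.layout.firm, h.layout.num_workers]
    rfl
  rw [proposeProg, wp_seq]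
  refine WP.mono (WP.same (wp_smallestProg (fam := fam) (by rwa [hfirm]) ?_)) ?_
  · intro m hm
    obtain ⟨L, hL, hd⟩ := k3 m hm
    rw [hd.length_eq, h.layout.num_contracts]
    simpa using L.card_le_univ
  rintro t₁ s₁ ⟨hs₁, ht₁, hcase⟩
  have hr1 : ∀ x, x < 2 ∨ x = 10 → s₁.reg x = s.reg x := by
    intro x hx
    refine hs₁.1 x ?_
    simp [Prog.regs, smallestProg, memberProg, Prog.incr, Prog.decr]
    omega
  have ha1 : ∀ b, s₁.arr b = s.arr b := by
    intro x
    refine hs₁.2 x ?_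
    simp [Prog.arrs, smallestProg, memberProg, Prog.incr, Prog.decr]
  rw [h10] at hcase
  rw [wp_seq, wp_ite]
  rcases hcase with ⟨h12, hno⟩ | ⟨m, hm, htight, h12, hst, hmin⟩
  · refine ⟨fun hne => ?_, fun _ => ?_⟩
    · simp [Expr.eval, hr1, h12] at hne
    simp only [wp_seq (p := Prog.setArr _ _ _), wp_setArr, wp_setReg]
    have hroom : ¬ I.NoRoom (Sum.inr (I.firm f)) M f := by
      rw [← noRoom_iff_of_family k3 k4 h.matching]
      rintro ⟨m, hm, h1⟩
      exact hno m hm h1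
    refine WP.mono (wp_refresh_both (M' := insert f M) (st' := st) (f := f) (r := f) h
      ?_ ?_ ?_ ?_ ?_ ?_ ?_) ?_
    · intro x hx
      simp only [Expr.eval]
      rw [Function.update_of_ne (by omega), hr1 x (Or.inl hx)]
    · simp [Expr.eval, hr1, h10]
    · simp [Expr.eval, hr1, h10]
    · intro b h6 h7
      simp [Expr.eval, h6, ha1]
    · intro e
      simp [Expr.eval, hr1, h10, ha1, Function.update_apply, Fin.val_inj, h.matching]
      split_ifs <;> simp_all
    · intro e
      simp [ha1, h.label]
    · intro x h1 _
      simp [h1]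
    · rintro t s' ⟨ht, hrep⟩
      refine ⟨?_, _, _, hrep, hI.accept hf hroom, ?_⟩
      · simp only [Expr.cost]
        rw [h.layout.num_contracts] at *
        omega
      · rw [progress_insert hf.1.1]
        omega
  · obtain ⟨L, hL, hd⟩ := k3 m hm
    have hmn : m.2.length ≤ n := by
      rw [hd.length_eq]
      simpa using L.card_le_univ
    refine ⟨fun _ => ?_, fun hne => ?_⟩
    swap
    · simp [Expr.eval, hr1, h12, h.layout.num_contracts] at hne
      omega
    simp only [wp_seq (p := worstProg), wp_seq (p := Prog.setArr _ _ _), wp_setArr]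
    refine WP.mono (WP.same (wp_worstProg (l := m.2) (by rwa [ha1]) h12)) ?_
    rintro t₂ s₂ ⟨hs₂, ht₂, h13, hmaxf, hmaxl⟩
    have hr2 : ∀ x, x < 2 ∨ x = 10 → s₂.reg x = s.reg x := by
      intro x hx
      rw [← hr1 x hx]
      refine hs₂.1 x ?_
      simp [Prog.regs, worstProg, Prog.incr, Prog.decr]
      omega
    have ha2 : ∀ b, s₂.arr b = s.arr b := by
      intro x
      rw [← ha1 x]
      refine hs₂.2 x ?_
      simp [Prog.arrs, worstProg, Prog.incr, Prog.decr]
    have hval : ∀ e, firmVal s₁ e = firmVal s e := by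
      intro e
      simp [firmVal, ha1]
    simp only [hval, ha1, hr1 10 (Or.inr rfl), h10] at h13 hmaxf hmaxl
    have hmem : ∀ e : Fin n, s.arr 6 e ≠ 0 ↔ e ∈ M := by
      intro e
      rw [h.matching]
      split_ifs with h1 <;> simp [h1]
    obtain ⟨r, hr13, hr⟩ : ∃ r : Fin n, s₂.reg 13 = r ∧ r ∈ insert f (M ∩ L) := by
      rcases h13 with h1 | ⟨h1, h2⟩
      · exact ⟨f, h1, Finset.mem_insert_self _ _⟩
      · obtain ⟨r, hrL, hr⟩ := hd.mem_iff.1 h1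
        rw [← hr, hmem] at h2
        exact ⟨r, hr.symm, Finset.mem_insert_of_mem (Finset.mem_inter.2 ⟨h2, hrL⟩)⟩
    rw [hr13] at hmaxf hmaxl
    have hmax : ∀ e ∈ insert f (M ∩ L), I.firmLevel e (st e) ≤ I.firmLevel r (st r) := by
      intro e he
      rw [← h.firmVal_eq, ← h.firmVal_eq]
      rcases Finset.mem_insert.1 he with rfl | he
      · exact hmaxf
      · rw [Finset.mem_inter] at he
        exact hmaxl e (hd.val_mem_iff.2 he.2) ((hmem e).2 he.1)
    have hrM : r ∈ insert f M := by
      simp only [Finset.mem_insert, Finset.mem_inter] at hr ⊢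
      tauto
    have hinv := hI.reject hf hL (hd.val_mem_iff.1 htight.1)
      (by rw [← hd.sum_eq h.matching, ← hd.1]; exact htight.2) (by
        intro L' hL' hfL' hq'
        obtain ⟨m', hm', hd'⟩ := k4 L' hL'
        rw [← hd.length_eq, ← hd'.length_eq]
        exact hmin m' hm' ⟨hd'.val_mem_iff.2 hfL', by rwa [hd'.sum_eq h.matching, hd'.1]⟩) hr hmax
    refine WP.mono (wp_refresh_both (M' := (insert f M).erase r)
      (st' := Function.update st r (st r + 1)) (f := f) (r := r) h ?_ ?_ ?_ ?_ ?_ ?_ ?_) ?_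
    · exact fun x hx => hr2 x (Or.inl hx)
    · exact (hr2 10 (Or.inr rfl)).trans h10
    · exact hr13
    · intro b h6 h7
      simp [h6, h7, ha2]
    · intro e
      simp [Expr.eval, hr13, hr2 10 (Or.inr rfl), h10, ha2, Function.update_apply, Fin.val_inj,
        h.matching]
      split_ifs <;> simp_all
    · intro e
      simp [Expr.eval, hr13, ha2, Function.update_apply, Fin.val_inj, h.label]
    · intro x h1 h2
      simp [h1, h2]
    · rintro t s' ⟨ht, hrep⟩
      refine ⟨?_, _, _, hrep, hinv, progress_reject hf.1.1 hrM⟩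
      simp only [Expr.cost]
      omega

/-- One iteration of the main loop. -/
def stepProg : Prog :=
  Prog.seq findProg (Prog.ite (Expr.reg 15) proposeProg Prog.skip)

theorem wp_stepProg {I : SMTILC (Fin nW) (Fin nF) (Fin n)} {M : Finset (Fin n)}
    {st : Fin n → ℕ} {s : RAM.State} (h : I.Represents M st s) (hI : I.Invariant M st) :
    WP stepProg s fun t s' => t ≤ 1403 * I.size ∧
      ((s'.reg 15 = 0 ∧ I.Represents M st s' ∧ ∀ f, ¬ I.Proposable M st f) ∨
      (s'.reg 15 = 1 ∧ ∃ M' st', I.Represents M' st' s' ∧ I.Invariant M' st' ∧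
        progress M st < progress M' st')) := by
  have hn := le_max_left n 1
  have hN := le_max_right n 1
  have hK := I.max_le_size
  have h0 := h.layout.num_contracts
  rw [stepProg, wp_seq]
  refine WP.mono (WP.same (wp_findProg ?_)) ?_
  · intro e he hel
    rw [h0] at he ⊢
    have hp := (h.eligible_iff ⟨e, he⟩).1 hel
    have h1 := h.workerVal_eq hp.2.1
    simp only at h1
    rw [h1]
    have h2 := tieIndex_lt (I.mem_contracts_worker ⟨e, he⟩)
    have h3 := hp.2.1
    simp only [workerLevel, level, Fintype.card_fin] at h2 ⊢
    split_ifs <;> omega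
  rintro t₁ s₁ ⟨hs₁, ht₁, hcase⟩
  rw [h0] at ht₁
  have hr1 : ∀ x < 2, s₁.reg x = s.reg x := by
    intro x hx
    refine hs₁.1 x ?_
    simp [Prog.regs, findProg, Prog.incr]
    omega
  have ha1 : ∀ b, s₁.arr b = s.arr b := by
    intro x
    refine hs₁.2 x ?_
    simp [Prog.arrs, findProg, Prog.incr]
  have hrep : I.Represents M st s₁ :=
    ⟨h.layout.congr hr1 fun b _ => ha1 b, by rw [ha1]; exact h.matching, by rw [ha1]; exact h.label,
      by rw [ha1]; exact h.room, by rw [ha1]; exact h.workerTie, by rw [ha1]; exact h.firmTie,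
      by rw [ha1]; exact h.shift_zero, by rw [ha1]; exact h.shift_one⟩
  rw [wp_ite, wp_skip]
  rcases hcase with ⟨h15, hno⟩ | ⟨h15, hlt, hel, hmin⟩
  · refine ⟨fun hne => absurd h15 hne, fun _ => ⟨?_, Or.inl ⟨h15, hrep, fun f hf => ?_⟩⟩⟩
    · simp only [Expr.cost]
      omega
    · exact hno f (by rw [h0]; exact f.2) ((h.eligible_iff f).2 hf)
  · refine ⟨fun _ => ?_, fun he => absurd (h15.symm.trans he) one_ne_zero⟩
    rw [h0] at hlt hmin
    have hp := (h.eligible_iff ⟨_, hlt⟩).1 hel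
    have hbest : I.BestProposable M st ⟨_, hlt⟩ := by
      refine ⟨hp, fun g hg => ?_⟩
      rw [← h.workerVal_eq hp.2.1, ← h.workerVal_eq hg.2.1]
      exact hmin g g.2 ((h.eligible_iff g).2 hg)
    refine WP.mono (WP.same (wp_proposeProg hrep hI rfl hbest)) ?_
    rintro t₂ s₂ ⟨hs₂, ht₂, hex⟩
    refine ⟨?_, Or.inr ⟨?_, hex⟩⟩
    · simp only [Expr.cost]
      omega
    · rw [← h15]
      refine hs₂.1 15 ?_
      simp [Prog.regs, proposeProg, smallestProg, worstProg, refreshProg, clearProg, fullProg,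
        memberProg, fillProg, Prog.incr, Prog.decr]

/-- Prepares the working memory. -/
def initProg : Prog :=
  Prog.seq (Prog.setArr 11 (Expr.lit 1) (Expr.add (Expr.reg 0) (Expr.reg 0)))
  (Prog.loop (Expr.sub (Expr.reg 0) (Expr.reg 16))
    (Prog.seq (Prog.setReg 3 (Expr.get 2 (Expr.get 0 (Expr.reg 16))))
    (Prog.seq (prefProg 9)
    (Prog.seq (Prog.setReg 3 (Expr.get 2 (Expr.add (Expr.reg 1) (Expr.get 1 (Expr.reg 16)))))
    (Prog.seq (prefProg 10)
    (Prog.seq (refreshProg 16)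
    (Prog.incr 16 (Expr.lit 1))))))))

theorem wp_prefProg_agent {I : SMTILC (Fin nW) (Fin nF) (Fin n)} {s : RAM.State} {b : ℕ}
    (hb : 4 ≠ b) {a : Fin nW ⊕ Fin nF} (hlay : I.Layout s) (h3 : s.reg 3 = s.arr 2 (agentCode a))
    {g : Fin n → ℕ} (hg : ∀ e ∈ I.contracts a, g e = I.tieIndex a e) :
    WP (prefProg b) s fun t s' => t ≤ 90 * I.size ∧
      (∀ e ∈ I.contracts a, s'.arr b e = g e) ∧
      ∀ e : Fin n, s.arr b e = g e → s'.arr b e = g e := by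
  obtain ⟨ties, h1, h2, h4, h5⟩ := hlay.exists_ties a
  refine WP.mono (wp_prefProg hb (ties := ties)
    (G := fun x => if hx : x < n then g ⟨x, hx⟩ else 0) ?_ (by rwa [h3])) ?_
  · intro i hi x hx
    obtain ⟨e, rfl, he, ht⟩ := h4 i hi x hx
    simp [hg e he, ht]
  · rintro t s' ⟨ht, hb⟩
    refine ⟨?_, fun e he => ?_, fun e he => ?_⟩
    · have := I.max_le_size
      omega
    · rw [hb, if_pos (h5 e he)]
      simp
    · rw [hb]
      by_cases hmem : (e : ℕ) ∈ ties.flatten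
      · rw [if_pos hmem]
        simp
      · rw [if_neg hmem]
        exact he

theorem wp_initProg {I : SMTILC (Fin nW) (Fin nF) (Fin n)} {s : RAM.State} (h : I.IsInput s) :
    WP initProg s fun t s' => t ≤ 600 * (I.size * max n 1) ∧ I.Represents ∅ (fun _ => 0) s' := by
  have hn := le_max_left n 1
  have hN := le_max_right n 1
  have hK := I.max_le_size
  simp only [initProg, wp_seq (p := Prog.setArr _ _ _), wp_setArr]
  set s₀ : RAM.State := ⟨s.reg, Function.update s.arr 11 (Function.update (s.arr 11)
    (Expr.eval s (Expr.lit 1)) (Expr.eval s ((Expr.reg 0).add (Expr.reg 0))))⟩ with hs0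
  have hlay0 : I.Layout s₀ := by
    refine h.layout.congr (fun _ _ => rfl) fun b hb => ?_
    rw [hs0]
    exact Function.update_of_ne (by omega) _ _
  refine WP.mono (wp_loop (fun (i : ℕ) s' => i ≤ n ∧ s'.reg 16 = i ∧
    ∀ e : Fin n, (e : ℕ) < i →
      (s'.arr 8 e = 0 ↔ ¬ I.NoRoom (Sum.inl (I.worker e)) ∅ e) ∧
      s'.arr 9 e = I.tieIndex (Sum.inl (I.worker e)) e ∧
      s'.arr 10 e = I.tieIndex (Sum.inr (I.firm e)) e)
    (fun i => 570 * (I.size * (n - i))) (b₀ := 0) ?_ ?_) ?_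
  · exact ⟨Nat.zero_le _, h.reg_clear 16 (by norm_num), fun e he => absurd he (Nat.not_lt_zero _)⟩
  · rintro i s' hs ⟨h1, h2, h3⟩ he
    have hr : ∀ x < 2, s'.reg x = s₀.reg x := by
      intro x hx
      refine hs.1 x ?_
      simp [Prog.regs, prefProg, refreshProg, clearProg, fullProg, memberProg, fillProg, Prog.incr,
        Prog.decr]
      omega
    have ha : ∀ b, b < 8 → s'.arr b = s₀.arr b := by
      intro x hx
      refine hs.2 x ?_
      simp [Prog.arrs, prefProg, refreshProg, clearProg, fullProg, memberProg, fillProg, Prog.incr,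
        Prog.decr]
      omega
    have hlay : I.Layout s' := hlay0.congr hr fun b hb => ha b (by omega)
    have hi : i < n := by
      simp only [Expr.eval, hlay.num_contracts, h2] at he
      omega
    have hwi : s'.arr 0 i = I.worker ⟨i, hi⟩ := hlay.worker ⟨i, hi⟩
    simp only [wp_seq, wp_setReg, Prog.incr]
    refine WP.mono (WP.same (wp_prefProg_agent (I := I) ?_
      (a := Sum.inl (I.worker ⟨i, hi⟩)) (g := fun e => I.tieIndex (Sum.inl (I.worker e)) e)
      ?_ ?_ ?_)) ?_
    · norm_num
    · exact hlay.congr (fun x hx => Function.update_of_ne (by omega) _ _) fun _ _ => rfl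
    · simp [Expr.eval, h2, hwi, agentCode]
    · intro e he
      rcases mem_contracts.1 he with h4 | h4
      · rw [h4]
      · simp at h4
    rintro t₁ s₁ ⟨hs₁, ht₁, k1, k2⟩
    have hr1 : ∀ x, x < 2 ∨ 6 < x → s₁.reg x = s'.reg x := by
      intro x hx
      refine (hs₁.1 x ?_).trans (Function.update_of_ne (by omega) _ _)
      simp [Prog.regs, prefProg, fillProg, Prog.incr, Prog.decr]
      omega
    have ha1 : ∀ b, b ≠ 9 → s₁.arr b = s'.arr b := by
      intro x hx
      refine hs₁.2 x ?_
      simp [Prog.arrs, prefProg, fillProg, Prog.incr, Prog.decr]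
      omega
    have hlay1 : I.Layout s₁ := hlay.congr (fun x hx => hr1 x (Or.inl hx))
      fun b hb => ha1 b (by omega)
    have hfi1 : s₁.arr 1 i = I.firm ⟨i, hi⟩ := hlay1.firm ⟨i, hi⟩
    refine WP.mono (WP.same (wp_prefProg_agent (I := I) ?_
      (a := Sum.inr (I.firm ⟨i, hi⟩)) (g := fun e => I.tieIndex (Sum.inr (I.firm e)) e)
      ?_ ?_ ?_)) ?_
    · norm_num
    · exact hlay1.congr (fun x hx => Function.update_of_ne (by omega) _ _) fun _ _ => rfl
    · simp [Expr.eval, hr1, h2, hfi1, agentCode, hlay.num_workers]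
    · intro e he
      rcases mem_contracts.1 he with h4 | h4
      · simp at h4
      · rw [h4]
    rintro t₂ s₂ ⟨hs₂, ht₂, k3, k4⟩
    have hr2 : ∀ x, x < 2 ∨ 6 < x → s₂.reg x = s'.reg x := by
      intro x hx
      refine (hs₂.1 x ?_).trans ((Function.update_of_ne (by omega) _ _).trans (hr1 x hx))
      simp [Prog.regs, prefProg, fillProg, Prog.incr, Prog.decr]
      omega
    have ha2 : ∀ b, b ≠ 10 → s₂.arr b = s₁.arr b := by
      intro x hx
      refine hs₂.2 x ?_
      simp [Prog.arrs, prefProg, fillProg, Prog.incr, Prog.decr]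
      omega
    have ha2' : ∀ b, b ≠ 9 → b ≠ 10 → s₂.arr b = s'.arr b := fun b h9 h10 =>
      (ha2 b h10).trans (ha1 b h9)
    have hin : (⟨i, hi⟩ : Fin n) ∈ I.contracts (Sum.inl (I.worker ⟨i, hi⟩)) :=
      I.mem_contracts_worker _
    have hlay2 : I.Layout s₂ := hlay.congr (fun x hx => hr2 x (Or.inl hx))
      fun b hb => ha2' b (by omega) (by omega)
    refine WP.mono (WP.same (wp_refresh (M := ∅) (f := ⟨i, hi⟩) (P := fun e => (e : ℕ) < i)
      hlay2 ?_ ?_ ?_)) ?_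
    · intro e
      rw [ha2' 6 (by norm_num) (by norm_num), ha 6 (by norm_num)]
      simpa [hs0] using h.arr_clear 6 (by norm_num) e
    · rw [hr2 16 (by norm_num), h2]
    · intro e he
      rw [ha2' 8 (by norm_num) (by norm_num)]
      exact (h3 e he).1
    rintro t₃ s₃ ⟨hs₃, ht₃, k5⟩
    have hr3 : s₃.reg 16 = i := by
      rw [← h2, ← hr2 16 (by norm_num)]
      refine hs₃.1 16 ?_
      simp [Prog.regs, refreshProg, clearProg, fullProg, memberProg, fillProg, Prog.incr, Prog.decr]
    have ha3 : ∀ b, b ≠ 8 → s₃.arr b = s₂.arr b := by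
      intro x hx
      refine hs₃.2 x ?_
      simp [Prog.arrs, refreshProg, clearProg, fullProg, memberProg, fillProg, Prog.incr, Prog.decr]
      omega
    refine ⟨i + 1, ?_, hi, ?_, fun e he => ?_⟩
    · have : n - i = n - (i + 1) + 1 := by omega
      rw [this, Nat.mul_add I.size]
      simp only [Expr.cost]
      omega
    · simp [Expr.eval, hr3]
    · have hcase : (e : ℕ) < i ∨ e = ⟨i, hi⟩ := by
        rcases Nat.lt_succ_iff_lt_or_eq.1 he with h | h
        · exact Or.inl h
        · exact Or.inr (Fin.ext h)
      refine ⟨k5 e ?_, ?_, ?_⟩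
      · rcases hcase with h | rfl
        exacts [Or.inl h, Or.inr rfl]
      · rw [ha3 9 (by norm_num), ha2 9 (by norm_num)]
        rcases hcase with h | rfl
        exacts [k2 e (h3 e h).2.1, k1 _ (I.mem_contracts_worker _)]
      · rw [ha3 10 (by norm_num)]
        rcases hcase with h | rfl
        · refine k4 e ?_
          rw [show s₁.arr 10 = s'.arr 10 from ha1 10 (by norm_num)]
          exact (h3 e h).2.2
        · exact k3 _ (I.mem_contracts_firm _)
  · rintro t s' ⟨ht, hs, he, i, h1, h2, h3⟩
    have hr : ∀ x < 2, s'.reg x = s₀.reg x := by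
      intro x hx
      refine hs.1 x ?_
      simp [Prog.regs, prefProg, refreshProg, clearProg, fullProg, memberProg, fillProg, Prog.incr,
        Prog.decr]
      omega
    have ha : ∀ b, b < 8 ∨ b = 11 → s'.arr b = s₀.arr b := by
      intro x hx
      refine hs.2 x ?_
      simp [Prog.arrs, prefProg, refreshProg, clearProg, fullProg, memberProg, fillProg, Prog.incr,
        Prog.decr]
      omega
    have hlay : I.Layout s' := hlay0.congr hr fun b hb => ha b (by omega)
    have hi : i = n := by
      simp only [Expr.eval, hlay.num_contracts, h2] at he
      omega
    subst hi
    refine ⟨?_, hlay, ?_, ?_, fun e => (h3 e e.2).1, fun e => (h3 e e.2).2.1,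
      fun e => (h3 e e.2).2.2, ?_, ?_⟩
    · have h5 : I.size * i ≤ I.size * max i 1 := Nat.mul_le_mul_left _ (le_max_left _ _)
      have h6 : I.size ≤ I.size * max i 1 := Nat.le_mul_of_pos_right _ (by omega)
      simp only [Expr.cost] at ht ⊢
      rw [Nat.sub_zero] at ht
      omega
    · intro e
      rw [ha 6 (by norm_num)]
      simpa [hs0] using h.arr_clear 6 (by norm_num) e
    · intro e
      rw [ha 7 (by norm_num)]
      simpa [hs0] using h.arr_clear 7 (by norm_num) e
    · rw [ha 11 (by norm_num)]
      simpa [hs0, Expr.eval] using h.arr_clear 11 (by norm_num) 0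
    · rw [ha 11 (by norm_num)]
      simp [hs0, Expr.eval, h.num_contracts]

/-- The algorithm. -/
def mainProg : Prog :=
  Prog.seq initProg
  (Prog.seq (Prog.setReg 15 (Expr.lit 1))
  (Prog.loop (Expr.reg 15) stepProg))

theorem wp_mainProg {I : SMTILC (Fin nW) (Fin nF) (Fin n)} {s : RAM.State} (h : I.IsInput s) :
    WP mainProg s fun t s' => t ≤ 20000 * (max I.nestingLevel 1 * max n 1 ^ 2) ∧
      ∃ M st, IsOutput M s' ∧ I.IsCertified M st := by
  have hN := le_max_right n 1
  have hK := I.max_le_size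
  simp only [mainProg, wp_seq, wp_setReg]
  refine WP.mono (wp_initProg h) ?_
  rintro t₁ s₁ ⟨ht₁, hrep⟩
  refine WP.mono (wp_loop (fun (x : (Finset (Fin n) × (Fin n → ℕ)) × ℕ) s' =>
      I.Represents x.1.1 x.1.2 s' ∧ I.Invariant x.1.1 x.1.2 ∧ s'.reg 15 = x.2 ∧
      (x.2 = 0 → ∀ f, ¬ I.Proposable x.1.1 x.1.2 f) ∧ x.2 ≤ 1)
    (fun x => 1410 * I.size * (7 * n - progress x.1.1 x.1.2 + x.2))
    (b₀ := ((∅, fun _ => 0), 1)) ?_ ?_) ?_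
  · refine ⟨?_, I.invariant_init, by simp [Expr.eval], by simp, le_rfl⟩
    obtain ⟨h1, h2, h3, h4, h5, h6, h7, h8⟩ := hrep
    exact ⟨h1.congr (fun x hx => Function.update_of_ne (by omega) _ _) fun _ _ => rfl,
      h2, h3, h4, h5, h6, h7, h8⟩
  · rintro ⟨⟨M, st⟩, b⟩ s' hs ⟨h1, h2, h3, h4, h5⟩ he
    simp only at h1 h2 h3 h4 h5
    have hb : b = 1 := by
      have h6 : b ≠ 0 := fun h6 => he (h3.trans h6)
      omega
    subst hb
    have hp := h2.progress_le
    rw [Fintype.card_fin] at hp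
    refine WP.mono (wp_stepProg h1 h2) ?_
    rintro t s'' ⟨ht, ⟨h6, h7, h8⟩ | ⟨h6, M', st', h7, h8, h9⟩⟩
    · refine ⟨((M, st), 0), ?_, h7, h2, h6, fun _ => h8, Nat.zero_le _⟩
      simp only [Expr.cost, Nat.mul_add]
      omega
    · refine ⟨((M', st'), 1), ?_, h7, h8, h6, fun h => absurd h one_ne_zero, le_rfl⟩
      have hp' := h8.progress_le
      rw [Fintype.card_fin] at hp'
      have h10 : 7 * n - progress M' st' + 1 + 1 ≤ 7 * n - progress M st + 1 := by omega
      have h11 := Nat.mul_le_mul_left (1410 * I.size) h10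
      rw [Nat.mul_add _ _ 1, Nat.mul_one] at h11
      simp only [Expr.cost]
      omega
  · rintro t₂ s₂ ⟨ht₂, hs, he, ⟨⟨M, st⟩, b⟩, h1, h2, h3, h4, h5⟩
    refine ⟨?_, M, st, h1.matching, h2.isCertified (h4 (h3.symm.trans he))⟩
    have h6 : 7 * n - progress (∅ : Finset (Fin n)) (fun _ => 0) + 1 ≤ 8 * max n 1 := by
      have := le_max_left n 1
      omega
    have h7 := Nat.mul_le_mul_left (1410 * I.size) h6
    have h8 : max I.nestingLevel 1 * max n 1 ^ 2 = I.size * max n 1 := by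
      rw [size, pow_two, mul_assoc]
    have h9 : 1410 * I.size * (8 * max n 1) = 11280 * (I.size * max n 1) := by ring
    have h10 : 1 ≤ I.size * max n 1 := Nat.mul_pos (by omega) (by omega)
    rw [h9] at h7
    rw [h8]
    simp only [Expr.cost] at ht₂ ⊢
    omega

end SMTILC

theorem theorem2 :
    ∃ (p : RAM.Prog) (C : ℕ), ∀ (nW nF n : ℕ) (I : SMTILC (Fin nW) (Fin nF) (Fin n))
      (s : RAM.State), I.IsInput s →
      ∃ (t : ℕ) (s' : RAM.State) (M : Finset (Fin n)),
        RAM.Exec p s t s' ∧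
        t ≤ C * (max I.nestingLevel 1 * (max n 1) ^ 2) ∧
        SMTILC.IsOutput M s' ∧
        I.IsStable M ∧
        ∀ Mopt : Finset (Fin n), I.IsMaxStable Mopt →
          (2 / 3 : ℚ) * (Mopt.card : ℚ) ≤ (M.card : ℚ) := by
  refine ⟨SMTILC.mainProg, 20000, fun nW nF n I s h => ?_⟩
  obtain ⟨t, s', hexec, ht, M, st, hout, hcert⟩ := SMTILC.wp_mainProg h
  refine ⟨t, s', M, hexec, ht, hout, hcert.isStable, fun Mopt hopt => ?_⟩
  have h1 := hcert.two_mul_card_le hopt.1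
  have h2 : (2 : ℚ) * Mopt.card ≤ 3 * M.card := by exact_mod_cast h1
  linarith
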